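/- Let $\mathcal M$ be a finite-dimensional smooth Riemannian manifold without boundary, with geodesic distance $d$, and let $\mathcal X\subset\mathcal M$ be compact and geodesically convex: any two points $x,y\in\mathcal X$ are joined by exactly one minimizing geodesic $\gamma_{xy}:[0,1]\to\mathcal X$ with $\gamma_{xy}(0)=x$, $\gamma_{xy}(1)=y$. Write $\mathrm{Exp}_x^{-1}(y):=\dot\gamma_{xy}(0)\in T_x\mathcal M$. Let $\xi\sim\mathcal P$ be a random element, let $\phi(x,\xi)$ be real-valued, with $\phi(x,\cdot)$ being $\mathcal P$-integrable for all $x$ in a neighbourhood of $\mathcal X$, and let $\Phi(x)=\mathbb E_\xi[\phi(x,\xi)]$. Assume: 1. $\Phi$ is differentiable at every point of $\mathcal X$ and $L$-smooth on $\mathcal X$ in one of the following two senses: (a) $\|\mathrm{grad}\,\Phi(y)-\Gamma_x^y\,\mathrm{grad}\,\Phi(x)\|\le L\,d(x,y)$ for all $x,y\in\mathcal X$, where $\Gamma_x^y$ is parallel transport along $\gamma_{xy}$; or (b) $\Phi(y)\le\Phi(x)+\langle\mathrm{grad}\,\Phi(x),\mathrm{Exp}_x^{-1}(y)\rangle_x+\frac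 L2 d(x,y)^2$ for all $x,y\in\mathcal X$. 2. For every $x\in\mathcal X$ and $\mathcal P$-almost every $\xi$, $\phi(\cdot,\xi)$ is differentiable at $x$ and $\|\mathrm{grad}\,\phi(x,\xi)\|\le C$. 3. The stochastic gradient $(x,\xi)\mapsto\mathrm{grad}\,\phi(x,\xi)$ is measurable on $\mathcal X$ and unbiased: $\mathbb E_\xi[\mathrm{grad}\,\phi(x,\xi)]=\mathrm{grad}\,\Phi(x)$ for all $x\in\mathcal X$. Stochastic Riemannian Frank–Wolfe with $K\ge1$ iterations, step sizes $\eta_k$ and batch sizes $b_k$ starts at some $x_0\in\mathcal X$. For $k=0,\dots,K-1$ it draws a batch of i.i.d. samples $\xi_1,\dots,\xi_{b_k}\sim\mathcal P$, independent of the past; picks $$y_k\in\operatorname*{argmin}_{y\in\mathcal X}\Big\langle\tfrac1{b_k}\sum_{i=1}^{b_k}\mathrm{grad}\,\phi(x_k,\xi_i),\ \mathrm{Exp}_{x_k}^{-1}(y)\Big\rangle_{x_k};$$ and sets $x_{k+1}=\gamma_{x_ky_k}(\eta_k)$; the iterates do not depend on samples drawn later. It returns $\hat x=x_N$, where $N$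 is uniform on $\{0,\dots,K-1\}$ and independent of the run. Let $$\mathcal G(x)=\max_{y\in\mathcal X}\big\langle\mathrm{Exp}_x^{-1}(y),-\mathrm{grad}\,\Phi(x)\big\rangle_x$$ be the Frank–Wolfe gap. Then there is a constant $B$, depending only on the problem data above (and not on $K$, on the initial point or on the run), such that for every $K\ge1$, with constant step sizes $\eta_k=1/\sqrt K$ and constant batch sizes $b_k=K$, $$\mathbb E[\mathcal G(\hat x)]\le\frac{B}{\sqrt K}.$$ -/

import Mathlib

open MeasureTheory ProbabilityTheory Set Filter Topology Bundle
open scoped Manifold ContDiff ENNReal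

noncomputable section

namespace SRFW

section Geometry

variable {E : Type*} [NormedAddCommGroup E] [NormedSpace ℝ E]
  {M : Type*} [EMetricSpace M] [ChartedSpace E M]
  [RiemannianBundle (fun x : M => TangentSpace 𝓘(ℝ, E) x)]

/-- The Riemannian gradient of `f` at `x`: the unique tangent vector representing the differential
of `f` at `x` through the inner product of the tangent space. -/
def grad [FiniteDimensional ℝ E] (f : M → ℝ) (x : M) : TangentSpace 𝓘(ℝ, E) x :=
  haveI : FiniteDimensional ℝ (TangentSpace 𝓘(ℝ, E) x) := inferInstanceAs (FiniteDimensional ℝ E)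
  haveI : CompleteSpace (TangentSpace 𝓘(ℝ, E) x) := FiniteDimensional.complete ℝ _
  (InnerProductSpace.toDual ℝ (TangentSpace 𝓘(ℝ, E) x)).symm
    (mfderiv 𝓘(ℝ, E) 𝓘(ℝ, ℝ) f x : TangentSpace 𝓘(ℝ, E) x →L[ℝ] ℝ)

/-- The velocity at time `t` of a curve `γ` parametrized by `[0, 1]` (one-sided at the
endpoints). -/
def velocity (γ : ℝ → M) (t : ℝ) : TangentSpace 𝓘(ℝ, E) (γ t) :=
  (mfderivWithin 𝓘(ℝ, ℝ) 𝓘(ℝ, E) γ (Icc (0 : ℝ) 1) t :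
    ℝ →L[ℝ] TangentSpace 𝓘(ℝ, E) (γ t)) (1 : ℝ)

/-- The Riemannian metric read in the preferred chart at `p`: the inner product of the images of
the coordinate vectors `v`, `w` at the point with coordinates `u`. -/
def metricInChart (p : M) (u v w : E) : ℝ :=
  inner ℝ
    (mfderiv 𝓘(ℝ, E) 𝓘(ℝ, E) (chartAt E p).symm u v : TangentSpace 𝓘(ℝ, E) ((chartAt E p).symm u))
    (mfderiv 𝓘(ℝ, E) 𝓘(ℝ, E) (chartAt E p).symm u w : TangentSpace 𝓘(ℝ, E) ((chartAt E p).symm u))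

/-- The Christoffel symbols of the first kind of the Levi-Civita connection, in the preferred chart
at `p`: with `g = metricInChart p`, the value is
`(∂_a g(b, w) + ∂_b g(a, w) - ∂_w g(a, b)) / 2` at the point with coordinates `u`. -/
def christoffel (p : M) (u a b w : E) : ℝ :=
  (fderiv ℝ (fun u' => metricInChart p u' b w) u a
    + fderiv ℝ (fun u' => metricInChart p u' a w) u b
    - fderiv ℝ (fun u' => metricInChart p u' a b) u w) / 2

/-- The vector field `V` along the curve `γ : [0, 1] → M` is parallel for the Levi-Civita
connection: at each time `t`, in the preferred chart at `γ t`, the coordinates `c` of `γ` and `v` of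
`V` are differentiable and `g(v' , w) + Γ(c', v; w) = 0` for all `w`. -/
def IsParallelAlong (γ : ℝ → M) (V : ∀ t : ℝ, TangentSpace 𝓘(ℝ, E) (γ t)) : Prop :=
  ∀ t ∈ Icc (0 : ℝ) 1, ∃ c' v' : E,
    HasDerivWithinAt (fun s => chartAt E (γ t) (γ s)) c' (Icc 0 1) t ∧
    HasDerivWithinAt
      (fun s => (mfderiv 𝓘(ℝ, E) 𝓘(ℝ, E) (chartAt E (γ t)) (γ s) (V s) : E)) v' (Icc 0 1) t ∧
    ∀ w : E,
      metricInChart (γ t) (chartAt E (γ t) (γ t)) v' w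
        + christoffel (γ t) (chartAt E (γ t) (γ t)) c'
            (mfderiv 𝓘(ℝ, E) 𝓘(ℝ, E) (chartAt E (γ t)) (γ t) (V t) : E) w = 0

/-- `v` is the parallel transport of `u` along `γ`, from time `0` to time `1`. -/
def IsParallelTransport (γ : ℝ → M) (u : TangentSpace 𝓘(ℝ, E) (γ 0))
    (v : TangentSpace 𝓘(ℝ, E) (γ 1)) : Prop :=
  ∃ V : ∀ t : ℝ, TangentSpace 𝓘(ℝ, E) (γ t), IsParallelAlong γ V ∧ V 0 = u ∧ V 1 = v

variable (E) in
/-- `γ : [0, 1] → M` is a minimizing geodesic: a smooth curve whose velocity is parallel along it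
(the geodesic equation) and whose speed, hence its length, is the distance of its endpoints. -/
structure IsMinGeodesic (γ : ℝ → M) : Prop where
  smooth : ContMDiffOn 𝓘(ℝ, ℝ) 𝓘(ℝ, E) ∞ γ (Icc 0 1)
  geodesic : IsParallelAlong γ (velocity (E := E) γ)
  speed : ∀ t ∈ Icc (0 : ℝ) 1, ‖velocity (E := E) γ t‖ₑ = edist (γ 0) (γ 1)

variable (E) in
/-- `γ` is a minimizing geodesic from `x` to `y` that stays in `X`. -/
structure IsGeodesicIn (X : Set M) (x y : M) (γ : ℝ → M) : Prop where
  minGeodesic : IsMinGeodesic E γ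
  mapsTo : MapsTo γ (Icc 0 1) X
  source : γ 0 = x
  target : γ 1 = y

variable (E) in
/-- `X` is geodesically convex: any two points of `X` are joined by exactly one minimizing geodesic
in `X`. -/
def IsGeodesicallyConvex (X : Set M) : Prop :=
  ∀ x ∈ X, ∀ y ∈ X, ∃ γ : ℝ → M, IsGeodesicIn E X x y γ ∧
    ∀ γ' : ℝ → M, IsGeodesicIn E X x y γ' → EqOn γ' γ (Icc 0 1)

/-- The inverse exponential map on `X`: `expInv X x y` is the initial velocity of the minimizing
geodesic from `x` to `y` in `X`. The equation is between elements of the tangent bundle, since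
`γ 0` and `x` are equal only propositionally. -/
def expInv (X : Set M) (x y : M) : TangentSpace 𝓘(ℝ, E) x :=
  Classical.epsilon fun v : TangentSpace 𝓘(ℝ, E) x =>
    ∃ γ : ℝ → M, IsGeodesicIn E X x y γ ∧
      (⟨γ 0, velocity γ 0⟩ : TangentBundle 𝓘(ℝ, E) M) = ⟨x, v⟩

variable [FiniteDimensional ℝ E]

variable (E) in
/-- The gradient of `Φ` is `L`-Lipschitz on `X`: gradients at two points of `X` are compared by
parallel transport along the geodesic that joins them in `X`. -/
def IsGradLipschitzOn (X : Set M) (L : ℝ) (Φ : M → ℝ) : Prop :=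
  ∀ x ∈ X, ∀ y ∈ X, ∀ γ : ℝ → M, IsGeodesicIn E X x y γ →
    ∃ v : TangentSpace 𝓘(ℝ, E) (γ 1), IsParallelTransport γ (grad Φ (γ 0)) v ∧
      ‖grad Φ (γ 1) - v‖ ≤ L * (edist x y).toReal

variable (E) in
/-- The quadratic upper bound
`Φ(y) ≤ Φ(x) + ⟨grad Φ(x), Exp_x⁻¹(y)⟩ + (L / 2) d(x, y)²` on `X`. -/
def HasQuadraticUpperBoundOn (X : Set M) (L : ℝ) (Φ : M → ℝ) : Prop :=
  ∀ x ∈ X, ∀ y ∈ X,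
    Φ y ≤ Φ x + inner ℝ (grad (E := E) Φ x) (expInv X x y) + L / 2 * (edist x y).toReal ^ 2

variable (E) in
/-- `Φ` is differentiable and `L`-smooth on `X`, in either of the two customary senses: through the
Lipschitz condition on the gradient, or through the quadratic upper bound. -/
def IsLSmoothOn (X : Set M) (L : ℝ) (Φ : M → ℝ) : Prop :=
  (∀ x ∈ X, MDifferentiableAt 𝓘(ℝ, E) 𝓘(ℝ, ℝ) Φ x) ∧
    (IsGradLipschitzOn E X L Φ ∨ HasQuadraticUpperBoundOn E X L Φ)

variable (E) in
/-- The Frank-Wolfe gap `G(x) = max_{y ∈ X} ⟨Exp_x⁻¹(y), -grad Φ(x)⟩`. -/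
def fwGap (X : Set M) (Φ : M → ℝ) (x : M) : ℝ :=
  ⨆ y : X, inner ℝ (expInv X x (y : M)) (-grad (E := E) Φ x)

end Geometry

section Algorithm

variable {E : Type*} [NormedAddCommGroup E] [NormedSpace ℝ E] [FiniteDimensional ℝ E]
  {M : Type*} [EMetricSpace M] [ChartedSpace E M]
  [RiemannianBundle (fun x : M => TangentSpace 𝓘(ℝ, E) x)]
  {Ξ : Type*} [MeasurableSpace Ξ]

variable (E) in
/-- The stochastic gradient is a measurable random field: `(x, ξ) ↦ grad φ(x, ξ)` is Borel
measurable from `X × Ξ` to the tangent bundle. -/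
def MeasurableGradOn [IsManifold 𝓘(ℝ, E) ∞ M] [MeasurableSpace M] (X : Set M) (φ : M → Ξ → ℝ) : Prop :=
  @Measurable (X × Ξ) (TangentBundle 𝓘(ℝ, E) M) _ (borel _)
    fun p => ⟨(p.1 : M), grad (fun z => φ z p.2) (p.1 : M)⟩

/-- The minibatch gradient `(1 / b) ∑ᵢ grad φ(x, ξᵢ)`. -/
def batchGrad (φ : M → Ξ → ℝ) {b : ℕ} (ξ : Fin b → Ξ) (x : M) : TangentSpace 𝓘(ℝ, E) x :=
  (1 / (b : ℝ)) • ∑ i, grad (fun z => φ z (ξ i)) x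

variable (E) in
/-- A run of stochastic Riemannian Frank-Wolfe on the feasible set `X`, for the stochastic objective
`φ` with samples from `P`, with `K` iterations, step sizes `η k` and batch sizes `b k`, on the
probability space `(Ω, μ)`. -/
structure Run [MeasurableSpace M] (X : Set M) (φ : M → Ξ → ℝ) (P : Measure Ξ) (K : ℕ)
    (η : ℕ → ℝ) (b : ℕ → ℕ) {Ω : Type*} [mΩ : MeasurableSpace Ω] (μ : Measure Ω) where
  /-- What is known before each iteration. -/
  ℱ : Filtration ℕ mΩ
  /-- The iterates `x_k`. -/
  x : ℕ → Ω → M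
  /-- The answers `y_k` of the linear oracle. -/
  y : ℕ → Ω → M
  /-- The `i`-th sample of the `k`-th batch. -/
  ξ : (k : ℕ) → Fin (b k) → Ω → Ξ
  /-- The index of the iterate that is returned. -/
  index : Ω → Fin K
  init_mem : ∀ s, x 0 s ∈ X
  /-- No iterate depends on samples that are drawn later. -/
  adapted : ∀ k ≤ K, Measurable[ℱ k] (x k)
  sample_measurable : ∀ k < K, ∀ i, Measurable[ℱ (k + 1)] (ξ k i)
  sample_law : ∀ k < K, ∀ i, μ.map (ξ k i) = P
  sample_indep : ∀ k < K, iIndepFun (ξ k) μ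
  /-- Each batch is independent of the past. -/
  batch_indep_past :
    ∀ k < K, Indep (⨆ i, MeasurableSpace.comap (ξ k i) inferInstance) (ℱ k) μ
  oracle_mem : ∀ k < K, ∀ s, y k s ∈ X
  /-- `y_k` minimizes `⟨(1 / b_k) ∑ᵢ grad φ(x_k, ξᵢ), Exp_{x_k}⁻¹(z)⟩` over `z ∈ X`. -/
  oracle_min : ∀ k < K, ∀ s, ∀ z ∈ X,
    inner ℝ (batchGrad (E := E) φ (fun i => ξ k i s) (x k s)) (expInv X (x k s) (y k s)) ≤
      inner ℝ (batchGrad (E := E) φ (fun i => ξ k i s) (x k s)) (expInv X (x k s) z)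
  /-- `x_{k+1} = γ(η_k)`, where `γ` is the geodesic from `x_k` to `y_k`. -/
  step : ∀ k < K, ∀ s, ∃ γ : ℝ → M, IsGeodesicIn E X (x k s) (y k s) γ ∧ x (k + 1) s = γ (η k)
  index_measurable : Measurable index
  index_uniform : ∀ k, μ (index ⁻¹' {k}) = (K : ℝ≥0∞)⁻¹
  index_indep : Indep (MeasurableSpace.comap index inferInstance) (ℱ K) μ

/-- The output: an iterate chosen uniformly at random among `x_0, …, x_{K-1}`. -/
def Run.output [MeasurableSpace M] {X : Set M} {φ : M → Ξ → ℝ} {P : Measure Ξ} {K : ℕ}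
    {η : ℕ → ℝ} {b : ℕ → ℕ} {Ω : Type*} [MeasurableSpace Ω] {μ : Measure Ω}
    (R : Run E X φ P K η b μ) (s : Ω) : M :=
  R.x (R.index s) s

end Algorithm

end SRFW

end

/-! Along the geodesic from `x` to `y` in `X`, both notions of smoothness give the descent
inequality `Φ(γ(τ)) ≤ Φ(x) + τ⟨grad Φ(x), Exp_x⁻¹(y)⟩ + (L/2)τ²d(x,y)²` (`IsLSmoothOn.apply_le`).
Let `D` bound the distances in `X`, and let `δ_k` be the error of the minibatch gradient at `x_k`.
As `y_k` is optimal for the minibatch gradient, the gap at `x_k` is at most `-⟨grad Φ(x_k),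
Exp⁻¹(y_k)⟩ + 2Dδ_k` (`fwGap_le`). Together (`Run.mul_fwGap_le`), `η G(x_k) ≤ Φ(x_k) - Φ(x_{k+1}) +
2Dη δ_k + η²|L|D²/2`. Summed over `k`, the differences of `Φ` telescope and stay bounded by
compactness; the uniform independent index turns the sum into an average (`Run.lintegral_index`).
Independence of the batch from the past lets `x_k` be frozen, and the variance of a mean of `b`
bounded vectors gives `E δ_k ≤ |C|/√b` (`Run.lintegral_batchError_le`). With `η = 1/√K` and `b = K`,
all three contributions are of order `1/√K`.

For the Lipschitz notion, the descent inequality rests on compatibility of the connection with the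
metric, checked in charts. The error bound needs joint measurability of `δ_k`, obtained from
finitely many charts. The gap itself need not be shown measurable: its lower Lebesgue integral is
dominated by that of a measurable bound. -/

namespace SRFW

/-! ### The Riemannian metric in a chart. -/

section Metric

variable {E : Type*} [NormedAddCommGroup E] [NormedSpace ℝ E]
  {M : Type*} [EMetricSpace M] [ChartedSpace E M]

theorem mfderiv_chartAt_symm_mfderiv_chartAt [IsManifold 𝓘(ℝ, E) ∞ M] (p : M) {x : M}
    (hx : x ∈ (chartAt E p).source) (v : E) :
    (mfderiv 𝓘(ℝ, E) 𝓘(ℝ, E) (chartAt E p).symm (chartAt E p x)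
      (mfderiv 𝓘(ℝ, E) 𝓘(ℝ, E) (chartAt E p) x v : E) : E) = v := by
  have : IsManifold 𝓘(ℝ, E) 1 M := IsManifold.of_le (n := ∞) (by simp)
  have h := (mdifferentiable_chart (I := 𝓘(ℝ, E)) p).symm_comp_deriv hx
  exact congrArg (fun A : E →L[ℝ] E => A v) h

theorem contMDiffOn_mfderiv_chartAt_symm [IsManifold 𝓘(ℝ, E) ∞ M] (p : M) (v : E) :
    ContMDiffOn 𝓘(ℝ, E) 𝓘(ℝ, E).tangent ∞
      (fun u : E => (⟨(chartAt E p).symm u,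
        mfderiv 𝓘(ℝ, E) 𝓘(ℝ, E) (chartAt E p).symm u v⟩ : TangentBundle 𝓘(ℝ, E) M))
      (chartAt E p).target := by
  have : IsManifold 𝓘(ℝ, E) 1 M := IsManifold.of_le (n := ∞) (by simp)
  have h := (contMDiffOn_chart_symm (I := 𝓘(ℝ, E)) (n := ∞) (x := p)).contMDiffOn_tangentMapWithin
    (m := ∞) (by simp) (chartAt E p).open_target.uniqueMDiffOn
  have h2 : ContMDiffOn 𝓘(ℝ, E) 𝓘(ℝ, E).tangent ∞
      (fun u : E => (⟨u, v⟩ : TangentBundle 𝓘(ℝ, E) E)) (chartAt E p).target := by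
    exact contMDiffOn_vectorSpace_iff_contDiffOn.2 contDiffOn_const
  refine (h.comp h2 (fun u hu => hu)).congr fun u hu => ?_
  simp only [Function.comp, tangentMapWithin]
  rw [mfderivWithin_of_isOpen (chartAt E p).open_target hu]

variable [RiemannianBundle (fun x : M => TangentSpace 𝓘(ℝ, E) x)]

theorem inner_eq_metricInChart [IsManifold 𝓘(ℝ, E) ∞ M] (p : M) {x : M}
    (hx : x ∈ (chartAt E p).source) (v w : TangentSpace 𝓘(ℝ, E) x) :
    inner ℝ v w = metricInChart p (chartAt E p x)
      (mfderiv 𝓘(ℝ, E) 𝓘(ℝ, E) (chartAt E p) x v : E)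
      (mfderiv 𝓘(ℝ, E) 𝓘(ℝ, E) (chartAt E p) x w : E) := by
  -- The chart round trip returns `x` only propositionally, so the equality of inner products is
  -- proved over a variable base point.
  have key : ∀ (y : M) (h : y = x) (a b : E), a = v → b = w →
      inner ℝ v w = @inner ℝ (TangentSpace 𝓘(ℝ, E) y) _ a b := by
    rintro y rfl a b rfl rfl; rfl
  exact key _ ((chartAt E p).left_inv hx) _ _ (mfderiv_chartAt_symm_mfderiv_chartAt p hx v)
    (mfderiv_chartAt_symm_mfderiv_chartAt p hx w)

theorem contDiffOn_metricInChart [IsManifold 𝓘(ℝ, E) ∞ M]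
    [IsContMDiffRiemannianBundle 𝓘(ℝ, E) ∞ E (fun x : M => TangentSpace 𝓘(ℝ, E) x)]
    (p : M) (v w : E) :
    ContDiffOn ℝ ∞ (fun u => metricInChart p u v w) (chartAt E p).target := by
  rw [← contMDiffOn_iff_contDiffOn]
  exact ContMDiffOn.inner_bundle (E := fun x : M => TangentSpace 𝓘(ℝ, E) x)
    (b := (chartAt E p).symm)
    (v := fun u => mfderiv 𝓘(ℝ, E) 𝓘(ℝ, E) (chartAt E p).symm u v)
    (w := fun u => mfderiv 𝓘(ℝ, E) 𝓘(ℝ, E) (chartAt E p).symm u w)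
    (contMDiffOn_mfderiv_chartAt_symm p v) (contMDiffOn_mfderiv_chartAt_symm p w)

/-- The Riemannian metric in the preferred chart at `p`, as a continuous bilinear form. -/
noncomputable def metricForm (p : M) (u : E) : E →L[ℝ] E →L[ℝ] ℝ :=
  let A : E →L[ℝ] TangentSpace 𝓘(ℝ, E) ((chartAt E p).symm u) :=
    mfderiv 𝓘(ℝ, E) 𝓘(ℝ, E) (chartAt E p).symm u
  (innerSL ℝ (E := TangentSpace 𝓘(ℝ, E) ((chartAt E p).symm u))).bilinearComp A A

theorem metricForm_apply (p : M) (u v w : E) :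
    metricForm p u v w = metricInChart p u v w := rfl

theorem metricInChart_comm (p : M) (u v w : E) :
    metricInChart p u v w = metricInChart p u w v := real_inner_comm _ _

theorem contDiffOn_metricForm [FiniteDimensional ℝ E] [IsManifold 𝓘(ℝ, E) ∞ M]
    [IsContMDiffRiemannianBundle 𝓘(ℝ, E) ∞ E (fun x : M => TangentSpace 𝓘(ℝ, E) x)]
    (p : M) : ContDiffOn ℝ ∞ (metricForm (E := E) p) (chartAt E p).target := by
  refine contDiffOn_clm_apply.2 fun v => contDiffOn_clm_apply.2 fun w => ?_
  exact contDiffOn_metricInChart p v w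

end Metric

/-! ### Calculus of bilinear forms. -/

section Bilinear

variable {E : Type*} [NormedAddCommGroup E] [NormedSpace ℝ E]

noncomputable instance instNormedAddCommGroupBilinear : NormedAddCommGroup (E →L[ℝ] E →L[ℝ] ℝ) :=
  ContinuousLinearMap.toNormedAddCommGroup

noncomputable instance instAddCommGroupBilinear : AddCommGroup (E →L[ℝ] E →L[ℝ] ℝ) :=
  NormedAddCommGroup.toAddCommGroup

noncomputable instance instNormedSpaceBilinear : NormedSpace ℝ (E →L[ℝ] E →L[ℝ] ℝ) :=
  ContinuousLinearMap.toNormedSpace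

noncomputable instance instNormedAddCommGroupTrilinear : NormedAddCommGroup (E →L[ℝ] E →L[ℝ] E →L[ℝ] ℝ) :=
  ContinuousLinearMap.toNormedAddCommGroup

theorem hasDerivWithinAt_bilinear_comp {G : E → E →L[ℝ] E →L[ℝ] ℝ} {G' : E →L[ℝ] E →L[ℝ] E →L[ℝ] ℝ}
    {c v w : ℝ → E} {c' v' w' : E} {S : Set ℝ} {t : ℝ} (hG : HasFDerivAt G G' (c t))
    (hc : HasDerivWithinAt c c' S t) (hv : HasDerivWithinAt v v' S t)
    (hw : HasDerivWithinAt w w' S t) :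
    HasDerivWithinAt (fun s => G (c s) (v s) (w s))
      (G' c' (v t) (w t) + G (c t) v' (w t) + G (c t) (v t) w') S t := by
  have h := ((hG.comp_hasDerivWithinAt t hc).clm_apply hv).clm_apply hw
  simpa using h

/-- The geodesic equation is homogeneous of degree two in time: acceleration scales by `τ²`, and the
Christoffel term is quadratic in the velocity. -/
theorem bilinear_christoffel_smul (G : E →L[ℝ] E →L[ℝ] ℝ) (D : E →L[ℝ] E →L[ℝ] E →L[ℝ] ℝ) (τ : ℝ)
    (v' c' v w : E) :
    G (τ • (τ • v')) w + (D (τ • c') (τ • v) w + D (τ • v) (τ • c') w - D w (τ • c') (τ • v)) / 2 =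
      τ ^ 2 * (G v' w + (D c' v w + D v c' w - D w c' v) / 2) := by
  simp only [map_smul, FunLike.coe_smul, Pi.smul_apply, smul_eq_mul]
  ring

end Bilinear

/-! ### Parallel fields and metric compatibility. -/

section Parallel

variable {E : Type*} [NormedAddCommGroup E] [NormedSpace ℝ E] [FiniteDimensional ℝ E]
  {M : Type*} [EMetricSpace M] [ChartedSpace E M] [IsManifold 𝓘(ℝ, E) ∞ M]
  [RiemannianBundle (fun x : M => TangentSpace 𝓘(ℝ, E) x)]
  [IsContMDiffRiemannianBundle 𝓘(ℝ, E) ∞ E (fun x : M => TangentSpace 𝓘(ℝ, E) x)]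

theorem hasFDerivAt_metricForm (p : M) {u : E} (hu : u ∈ (chartAt E p).target) :
    HasFDerivAt (metricForm (E := E) p) (fderiv ℝ (metricForm (E := E) p) u) u :=
  (((contDiffOn_metricForm p).contDiffAt ((chartAt E p).open_target.mem_nhds hu)).differentiableAt
    (by simp)).hasFDerivAt

theorem fderiv_metricInChart (p : M) {u : E} (hu : u ∈ (chartAt E p).target) (a b w : E) :
    fderiv ℝ (fun u' => metricInChart p u' b w) u a = fderiv ℝ (metricForm (E := E) p) u a b w := by
  have h := ((hasFDerivAt_metricForm p hu).clm_apply (hasFDerivAt_const b u)).clm_apply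
    (hasFDerivAt_const w u)
  rw [show (fun u' => metricInChart p u' b w) = fun u' => metricForm (E := E) p u' b w from rfl,
    h.fderiv]
  simp

theorem christoffel_eq (p : M) {u : E} (hu : u ∈ (chartAt E p).target) (a b w : E) :
    christoffel p u a b w = (fderiv ℝ (metricForm (E := E) p) u a b w
      + fderiv ℝ (metricForm (E := E) p) u b a w - fderiv ℝ (metricForm (E := E) p) u w a b) / 2 := by
  simp only [christoffel, fderiv_metricInChart p hu]

theorem fderiv_metricForm_comm (p : M) {u : E} (hu : u ∈ (chartAt E p).target) (a b w : E) :
    fderiv ℝ (metricForm (E := E) p) u a b w = fderiv ℝ (metricForm (E := E) p) u a w b := by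
  simp only [← fderiv_metricInChart p hu, metricInChart_comm p _ b w]

theorem metricInChart_add_christoffel_smul (p : M) {u : E} (hu : u ∈ (chartAt E p).target) (τ : ℝ)
    (v' c' v w : E) :
    metricInChart p u (τ • (τ • v')) w + christoffel p u (τ • c') (τ • v) w =
      τ ^ 2 * (metricInChart p u v' w + christoffel p u c' v w) := by
  rw [christoffel_eq p hu, christoffel_eq p hu, ← metricForm_apply, ← metricForm_apply]
  exact bilinear_christoffel_smul _ _ τ v' c' v w

/-- Metric compatibility in coordinates: in `Γ(c, v; w) + Γ(c, w; v)` the derivatives along `v` and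
`w` cancel by symmetry of the metric, leaving its derivative along `c`. -/
theorem fderiv_metricForm_add (p : M) {u : E} (hu : u ∈ (chartAt E p).target) (c v w v' w' : E) :
    fderiv ℝ (metricForm (E := E) p) u c v w + metricForm p u v' w + metricForm p u v w' =
      (metricInChart p u v' w + christoffel p u c v w)
        + (metricInChart p u w' v + christoffel p u c w v) := by
  rw [christoffel_eq p hu, christoffel_eq p hu, metricInChart_comm p u w' v,
    fderiv_metricForm_comm p hu c w v, metricForm_apply, metricForm_apply]
  ring

/-- The Levi-Civita connection is compatible with the metric: the inner product of two parallel
vector fields along a curve has zero derivative. -/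
theorem IsParallelAlong.hasDerivWithinAt_inner {γ : ℝ → M}
    {V W : ∀ t : ℝ, TangentSpace 𝓘(ℝ, E) (γ t)} (hγ : ContinuousOn γ (Icc 0 1))
    (hV : IsParallelAlong γ V) (hW : IsParallelAlong γ W) {t : ℝ} (ht : t ∈ Icc (0 : ℝ) 1) :
    HasDerivWithinAt (fun s => inner ℝ (V s) (W s)) 0 (Icc 0 1) t := by
  obtain ⟨c', v', hc, hv, hv'⟩ := hV t ht
  obtain ⟨c'', w', hc₂, hw, hw'⟩ := hW t ht
  obtain rfl : c' = c'' := (uniqueDiffOn_Icc zero_lt_one t ht).eq_deriv _ hc hc₂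
  have hsrc := mem_chart_source E (γ t)
  have hu := (chartAt E (γ t)).map_source hsrc
  have key := hasDerivWithinAt_bilinear_comp (hasFDerivAt_metricForm (γ t) hu) hc hv hw
  have h0 := hv' (mfderiv 𝓘(ℝ, E) 𝓘(ℝ, E) (chartAt E (γ t)) (γ t) (W t) : E)
  have h1 := hw' (mfderiv 𝓘(ℝ, E) 𝓘(ℝ, E) (chartAt E (γ t)) (γ t) (V t) : E)
  refine (key.congr_of_eventuallyEq ?_ ?_).congr_deriv ?_
  · filter_upwards [(hγ t ht).preimage_mem_nhdsWithin
      ((chartAt E (γ t)).open_source.mem_nhds hsrc)] with s hs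
    exact inner_eq_metricInChart (γ t) hs _ _
  · exact inner_eq_metricInChart (γ t) hsrc _ _
  · exact (fderiv_metricForm_add _ hu c' _ _ v' w').trans ((congrArg₂ (· + ·) h0 h1).trans (add_zero 0))

theorem IsParallelAlong.inner_eq {γ : ℝ → M}
    {V W : ∀ t : ℝ, TangentSpace 𝓘(ℝ, E) (γ t)} (hγ : ContinuousOn γ (Icc 0 1))
    (hV : IsParallelAlong γ V) (hW : IsParallelAlong γ W) :
    inner ℝ (V 1) (W 1) = inner ℝ (V 0) (W 0) := by
  have h := fun t (ht : t ∈ Icc (0 : ℝ) 1) => hV.hasDerivWithinAt_inner hγ hW ht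
  refine constant_of_has_deriv_right_zero (f := fun s => inner ℝ (V s) (W s))
    (fun t ht => (h t ht).continuousWithinAt) (fun t ht => ?_) 1 (right_mem_Icc.2 zero_le_one)
  exact (h t (Ico_subset_Icc_self ht)).mono_of_mem_nhdsWithin (Icc_mem_nhdsGE_of_mem ht)

end Parallel

/-! ### Velocity of curves and change of time. -/

section Geodesic

variable {E : Type*} [NormedAddCommGroup E] [NormedSpace ℝ E]
  {M : Type*} [EMetricSpace M] [ChartedSpace E M]

/-- The derivative is taken within `[0, 1]`, so values outside are irrelevant. Equality is in the
tangent bundle because the base points are not definitionally equal. -/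
theorem velocity_congr {γ γ' : ℝ → M} (h : EqOn γ' γ (Icc 0 1)) {t : ℝ} (ht : t ∈ Icc (0 : ℝ) 1) :
    (⟨γ' t, velocity γ' t⟩ : TangentBundle 𝓘(ℝ, E) M) = ⟨γ t, velocity γ t⟩ := by
  have h1 : ∀ (y : M) (v : E), y = γ t → v = velocity (E := E) γ t →
      (⟨y, v⟩ : TangentBundle 𝓘(ℝ, E) M) = ⟨γ t, velocity γ t⟩ := by
    rintro _ _ rfl rfl; rfl
  refine h1 _ _ (h ht) ?_
  exact congrArg (fun A : ℝ →L[ℝ] E => A 1)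
    (mfderivWithin_congr (I := 𝓘(ℝ, ℝ)) (I' := 𝓘(ℝ, E)) h (h ht))

theorem mul_mem_unitInterval {τ s : ℝ} (hτ : τ ∈ Icc (0 : ℝ) 1) (hs : s ∈ Icc (0 : ℝ) 1) :
    τ * s ∈ Icc (0 : ℝ) 1 :=
  ⟨mul_nonneg hτ.1 hs.1, mul_le_one₀ hτ.2 hs.1 hs.2⟩

theorem velocity_comp_mul {γ : ℝ → M} (hγ : MDifferentiableOn 𝓘(ℝ, ℝ) 𝓘(ℝ, E) γ (Icc 0 1)) {τ : ℝ}
    (hτ : τ ∈ Icc (0 : ℝ) 1) {s : ℝ} (hs : s ∈ Icc (0 : ℝ) 1) :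
    velocity (E := E) (fun r => γ (τ * r)) s = τ • velocity (E := E) γ (τ * s) := by
  have hd : HasDerivWithinAt (fun r : ℝ => τ * r) τ (Icc 0 1) s := by
    simpa using ((hasDerivAt_id s).const_mul τ).hasDerivWithinAt
  have hm : HasMFDerivWithinAt 𝓘(ℝ, ℝ) 𝓘(ℝ, ℝ) (fun r : ℝ => τ * r) (Icc 0 1) s
      (ContinuousLinearMap.toSpanSingleton ℝ τ) := hd.hasFDerivWithinAt.hasMFDerivWithinAt
  have h := (hγ _ (mul_mem_unitInterval hτ hs)).hasMFDerivWithinAt.comp s hm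
    (fun r hr => mul_mem_unitInterval hτ hr)
  have h' := h.mfderivWithin ((uniqueDiffOn_Icc zero_lt_one).uniqueMDiffOn s hs)
  have h2 : velocity (E := E) (fun r => γ (τ * r)) s =
    (mfderivWithin 𝓘(ℝ, ℝ) 𝓘(ℝ, E) γ (Icc (0 : ℝ) 1) (τ * s) : ℝ →L[ℝ] E) ((1 : ℝ) • τ) :=
    congrArg (fun A : ℝ →L[ℝ] E => A 1) h'
  rw [h2, one_smul]
  have h3 := map_smul
    (mfderivWithin 𝓘(ℝ, ℝ) 𝓘(ℝ, E) γ (Icc (0 : ℝ) 1) (τ * s) : ℝ →L[ℝ] E) τ (1 : ℝ)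
  rw [smul_eq_mul, mul_one] at h3
  exact h3

variable [RiemannianBundle (fun x : M => TangentSpace 𝓘(ℝ, E) x)]

theorem IsMinGeodesic.mdifferentiableOn {γ : ℝ → M} (h : IsMinGeodesic E γ) :
    MDifferentiableOn 𝓘(ℝ, ℝ) 𝓘(ℝ, E) γ (Icc 0 1) := h.smooth.mdifferentiableOn (by simp)

end Geodesic

/-! ### The geodesic equation after slowing down. -/

section Restriction

variable {E : Type*} [NormedAddCommGroup E] [NormedSpace ℝ E] [FiniteDimensional ℝ E]
  {M : Type*} [EMetricSpace M] [ChartedSpace E M] [IsManifold 𝓘(ℝ, E) ∞ M]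
  [RiemannianBundle (fun x : M => TangentSpace 𝓘(ℝ, E) x)]
  [IsContMDiffRiemannianBundle 𝓘(ℝ, E) ∞ E (fun x : M => TangentSpace 𝓘(ℝ, E) x)]

theorem IsParallelAlong.velocity_comp_mul {γ : ℝ → M}
    (hγ : MDifferentiableOn 𝓘(ℝ, ℝ) 𝓘(ℝ, E) γ (Icc 0 1))
    (h : IsParallelAlong γ (velocity (E := E) γ)) {τ : ℝ} (hτ : τ ∈ Icc (0 : ℝ) 1) :
    IsParallelAlong (fun r => γ (τ * r)) (velocity (E := E) fun r => γ (τ * r)) := by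
  intro s hs
  have hτs := mul_mem_unitInterval hτ hs
  obtain ⟨c', v', hc, hv, hvc⟩ := h (τ * s) hτs
  have hd : HasDerivWithinAt (fun r : ℝ => τ * r) τ (Icc 0 1) s := by
    simpa using ((hasDerivAt_id s).const_mul τ).hasDerivWithinAt
  have hmaps : MapsTo (fun r : ℝ => τ * r) (Icc 0 1) (Icc 0 1) :=
    fun r hr => mul_mem_unitInterval hτ hr
  have key : ∀ r ∈ Icc (0 : ℝ) 1, (mfderiv 𝓘(ℝ, E) 𝓘(ℝ, E) (chartAt E (γ (τ * s))) (γ (τ * r))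
      (velocity (fun r => γ (τ * r)) r) : E) =
      τ • (mfderiv 𝓘(ℝ, E) 𝓘(ℝ, E) (chartAt E (γ (τ * s))) (γ (τ * r))
      (velocity γ (τ * r)) : E) := by
    intro r hr
    rw [SRFW.velocity_comp_mul hγ hτ hr]
    exact map_smul (mfderiv 𝓘(ℝ, E) 𝓘(ℝ, E) (chartAt E (γ (τ * s))) (γ (τ * r)) : E →L[ℝ] E) _ _
  refine ⟨τ • c', τ • (τ • v'), hc.scomp s hd hmaps, ?_, fun w => ?_⟩
  · exact ((hv.scomp s hd hmaps).const_smul τ).congr key (key s hs)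
  · have hu := (chartAt E (γ (τ * s))).map_source (mem_chart_source E (γ (τ * s)))
    have h1 := congrArg (fun v => metricInChart (γ (τ * s)) (chartAt E (γ (τ * s)) (γ (τ * s)))
      (τ • (τ • v')) w + christoffel (γ (τ * s)) (chartAt E (γ (τ * s)) (γ (τ * s))) (τ • c') v w)
      (key s hs)
    refine (h1.trans (metricInChart_add_christoffel_smul _ hu τ v' c' _ w)).trans ?_
    rw [hvc w, mul_zero]

end Restriction

/-! ### Initial arcs of minimizing geodesics are minimizing. -/

section Distance

variable {E : Type*} [NormedAddCommGroup E] [NormedSpace ℝ E]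
  {M : Type*} [EMetricSpace M] [ChartedSpace E M]
  [RiemannianBundle (fun x : M => TangentSpace 𝓘(ℝ, E) x)]

theorem IsMinGeodesic.edist_ne_top {γ : ℝ → M} (h : IsMinGeodesic E γ) :
    edist (γ 0) (γ 1) ≠ ⊤ := by
  rw [← h.speed 0 (left_mem_Icc.2 zero_le_one)]
  exact enorm_ne_top

theorem IsMinGeodesic.norm_velocity {γ : ℝ → M} (h : IsMinGeodesic E γ) {t : ℝ}
    (ht : t ∈ Icc (0 : ℝ) 1) : ‖velocity (E := E) γ t‖ = (edist (γ 0) (γ 1)).toReal := by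
  rw [← h.speed t ht, toReal_enorm]

variable [IsManifold 𝓘(ℝ, E) ∞ M] [IsRiemannianManifold 𝓘(ℝ, E) M]

/-- The distance is at most the length of the arc, and the speed is constant. -/
theorem IsMinGeodesic.edist_le {γ : ℝ → M} (h : IsMinGeodesic E γ) {a b : ℝ} (ha : 0 ≤ a)
    (hab : a ≤ b) (hb : b ≤ 1) :
    edist (γ a) (γ b) ≤ ENNReal.ofReal (b - a) * edist (γ 0) (γ 1) := by
  have : IsManifold 𝓘(ℝ, E) 1 M := IsManifold.of_le (n := ∞) (by simp)
  rw [IsRiemannianManifold.out (I := 𝓘(ℝ, E)) (γ a) (γ b)]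
  refine (Manifold.riemannianEDist_le_pathELength
    ((h.smooth.of_le (by simp)).mono (Icc_subset_Icc ha hb)) rfl rfl hab).trans ?_
  rw [Manifold.pathELength_eq_lintegral_mfderiv_Ioo]
  rw [setLIntegral_congr_fun (g := fun _ => edist (γ 0) (γ 1)) measurableSet_Ioo]
  · simp [mul_comm]
  · intro t ht
    have ht' : t ∈ Icc (0 : ℝ) 1 := ⟨ha.trans ht.1.le, ht.2.le.trans hb⟩
    have hn : Icc (0 : ℝ) 1 ∈ 𝓝 t := Icc_mem_nhds (ha.trans_lt ht.1) (ht.2.trans_le hb)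
    beta_reduce
    rw [← h.speed t ht', velocity, mfderivWithin_of_mem_nhds hn]
    rfl

/-- The upper bounds for the two arcs cut at `τ` add up to the full distance, so the triangle
inequality leaves no slack. Cancelling the second arc needs a finite distance. -/
theorem IsMinGeodesic.edist_eq {γ : ℝ → M} (h : IsMinGeodesic E γ) {τ : ℝ}
    (hτ : τ ∈ Icc (0 : ℝ) 1) :
    edist (γ 0) (γ τ) = ENNReal.ofReal τ * edist (γ 0) (γ 1) := by
  refine le_antisymm (by simpa using h.edist_le le_rfl hτ.1 hτ.2) ?_
  have h1 := h.edist_le hτ.1 hτ.2 le_rfl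
  have h2 := (edist_triangle (γ 0) (γ τ) (γ 1)).trans (add_le_add_right h1 _)
  have h3 : edist (γ 0) (γ 1) = ENNReal.ofReal τ * edist (γ 0) (γ 1)
      + ENNReal.ofReal (1 - τ) * edist (γ 0) (γ 1) := by
    rw [← add_mul, ← ENNReal.ofReal_add hτ.1 (by linarith [hτ.2])]
    simp
  refine (ENNReal.add_le_add_iff_right ?_).1 (h3.symm.le.trans h2)
  exact ENNReal.mul_ne_top ENNReal.ofReal_ne_top h.edist_ne_top

variable [FiniteDimensional ℝ E]
  [IsContMDiffRiemannianBundle 𝓘(ℝ, E) ∞ E (fun x : M => TangentSpace 𝓘(ℝ, E) x)]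

theorem IsMinGeodesic.comp_mul {γ : ℝ → M} (h : IsMinGeodesic E γ) {τ : ℝ}
    (hτ : τ ∈ Icc (0 : ℝ) 1) : IsMinGeodesic E (fun r => γ (τ * r)) where
  smooth := by
    refine h.smooth.comp (f := fun r : ℝ => τ * r) ?_ fun r hr => mul_mem_unitInterval hτ hr
    rw [contMDiffOn_iff_contDiffOn]
    fun_prop
  geodesic := h.geodesic.velocity_comp_mul h.mdifferentiableOn hτ
  speed := by
    intro t ht
    rw [velocity_comp_mul h.mdifferentiableOn hτ ht, enorm_smul,
      h.speed _ (mul_mem_unitInterval hτ ht), mul_zero, mul_one, h.edist_eq hτ,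
      Real.enorm_eq_ofReal hτ.1]

theorem IsGeodesicIn.comp_mul {X : Set M} {x y : M} {γ : ℝ → M} (h : IsGeodesicIn E X x y γ) {τ : ℝ}
    (hτ : τ ∈ Icc (0 : ℝ) 1) : IsGeodesicIn E X x (γ τ) (fun r => γ (τ * r)) where
  minGeodesic := h.minGeodesic.comp_mul hτ
  mapsTo := fun _ hr => h.mapsTo (mul_mem_unitInterval hτ hr)
  source := by rw [mul_zero, h.source]
  target := by rw [mul_one]

end Distance

/-! ### The inverse exponential map. -/

section ExpInv

variable {E : Type*} [NormedAddCommGroup E] [NormedSpace ℝ E]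
  {M : Type*} [EMetricSpace M] [ChartedSpace E M]
  [RiemannianBundle (fun x : M => TangentSpace 𝓘(ℝ, E) x)]

/-- Uniqueness of the geodesic makes the choice hidden in `expInv` harmless: every admissible
geodesic has the chosen initial velocity. -/
theorem IsGeodesicIn.mk_expInv {X : Set M} (hX : IsGeodesicallyConvex E X) {x y : M} (hx : x ∈ X)
    (hy : y ∈ X) {γ : ℝ → M} (h : IsGeodesicIn E X x y γ) :
    (⟨x, expInv X x y⟩ : TangentBundle 𝓘(ℝ, E) M) = ⟨γ 0, velocity γ 0⟩ := by
  obtain ⟨γ₀, hγ₀, huniq⟩ := hX x hx y hy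
  have hex : ∃ v : TangentSpace 𝓘(ℝ, E) x, ∃ γ : ℝ → M, IsGeodesicIn E X x y γ ∧
      (⟨γ 0, velocity γ 0⟩ : TangentBundle 𝓘(ℝ, E) M) = ⟨x, v⟩ := by
    obtain rfl := h.source
    exact ⟨_, γ, h, rfl⟩
  obtain ⟨γ₁, hγ₁, h₁⟩ := Classical.epsilon_spec hex
  have h0 : (0 : ℝ) ∈ Icc (0 : ℝ) 1 := left_mem_Icc.2 zero_le_one
  exact h₁.symm.trans ((velocity_congr (huniq _ hγ₁) h0).trans (velocity_congr (huniq _ h) h0).symm)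

theorem enorm_expInv {X : Set M} (hX : IsGeodesicallyConvex E X) {x y : M} (hx : x ∈ X)
    (hy : y ∈ X) : ‖(expInv X x y : TangentSpace 𝓘(ℝ, E) x)‖ₑ = edist x y := by
  obtain ⟨γ, hγ, -⟩ := hX x hx y hy
  have h := congrArg (fun p : TangentBundle 𝓘(ℝ, E) M => ‖p.2‖ₑ) (hγ.mk_expInv hX hx hy)
  refine h.trans ((hγ.minGeodesic.speed 0 (left_mem_Icc.2 zero_le_one)).trans ?_)
  rw [hγ.source, hγ.target]

theorem norm_expInv {X : Set M} (hX : IsGeodesicallyConvex E X) {x y : M} (hx : x ∈ X)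
    (hy : y ∈ X) : ‖(expInv X x y : TangentSpace 𝓘(ℝ, E) x)‖ = (edist x y).toReal := by
  rw [← enorm_expInv hX hx hy, toReal_enorm]

theorem expInv_self {X : Set M} (hX : IsGeodesicallyConvex E X) {x : M} (hx : x ∈ X) :
    (expInv X x x : TangentSpace 𝓘(ℝ, E) x) = 0 := by
  rw [← norm_eq_zero, norm_expInv hX hx hx, edist_self, ENNReal.toReal_zero]

theorem edist_ne_top_of_isGeodesicallyConvex {X : Set M} (hX : IsGeodesicallyConvex E X) {x y : M}
    (hx : x ∈ X) (hy : y ∈ X) : edist x y ≠ ⊤ := by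
  rw [← enorm_expInv hX hx hy]
  exact enorm_ne_top

theorem exists_edist_le {X : Set M} (hc : IsCompact X)
    (hX : IsGeodesicallyConvex E X) :
    ∃ D : ℝ, 0 ≤ D ∧ ∀ x ∈ X, ∀ y ∈ X, (edist x y).toReal ≤ D := by
  rcases X.eq_empty_or_nonempty with rfl | hne
  · exact ⟨0, le_rfl, by simp⟩
  obtain ⟨p, hp, hmax⟩ := (hc.prod hc).exists_isMaxOn (hne.prod hne)
    (f := fun p : M × M => edist p.1 p.2) (by fun_prop)
  refine ⟨(edist p.1 p.2).toReal, ENNReal.toReal_nonneg, fun x hx y hy => ?_⟩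
  exact ENNReal.toReal_mono (edist_ne_top_of_isGeodesicallyConvex hX hp.1 hp.2)
    (hmax (mk_mem_prod hx hy))

end ExpInv

/-! ### The descent inequality. -/

section Gradient

variable {E : Type*} [NormedAddCommGroup E] [NormedSpace ℝ E] [FiniteDimensional ℝ E]
  {M : Type*} [EMetricSpace M] [ChartedSpace E M]
  [RiemannianBundle (fun x : M => TangentSpace 𝓘(ℝ, E) x)]

theorem inner_grad (f : M → ℝ) (x : M) (v : TangentSpace 𝓘(ℝ, E) x) :
    inner ℝ (grad f x) v = (mfderiv 𝓘(ℝ, E) 𝓘(ℝ, ℝ) f x : TangentSpace 𝓘(ℝ, E) x →L[ℝ] ℝ) v :=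
  haveI : FiniteDimensional ℝ (TangentSpace 𝓘(ℝ, E) x) := inferInstanceAs (FiniteDimensional ℝ E)
  haveI : CompleteSpace (TangentSpace 𝓘(ℝ, E) x) := FiniteDimensional.complete ℝ _
  InnerProductSpace.toDual_symm_apply

theorem inner_grad_congr (f : M → ℝ) {x x' : M} {v : TangentSpace 𝓘(ℝ, E) x}
    {v' : TangentSpace 𝓘(ℝ, E) x'} (h : (⟨x, v⟩ : TangentBundle 𝓘(ℝ, E) M) = ⟨x', v'⟩) :
    inner ℝ (grad f x) v = inner ℝ (grad f x') v' := by
  cases h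
  rfl

theorem hasDerivWithinAt_comp_curve {γ : ℝ → M} {f : M → ℝ} {t : ℝ}
    (hf : MDifferentiableAt 𝓘(ℝ, E) 𝓘(ℝ, ℝ) f (γ t))
    (hγ : MDifferentiableWithinAt 𝓘(ℝ, ℝ) 𝓘(ℝ, E) γ (Icc 0 1) t) :
    HasDerivWithinAt (fun s => f (γ s)) (inner ℝ (grad (E := E) f (γ t)) (velocity γ t))
      (Icc 0 1) t := by
  have h := (hf.hasMFDerivAt.comp_hasMFDerivWithinAt t hγ.hasMFDerivWithinAt)
  have key : ∀ A : ℝ →L[ℝ] ℝ, HasFDerivWithinAt (fun s => f (γ s)) A (Icc 0 1) t →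
      HasDerivWithinAt (fun s => f (γ s)) (A 1) (Icc 0 1) t := fun A hA => hA.hasDerivWithinAt
  rw [inner_grad]
  exact key ((mfderiv 𝓘(ℝ, E) 𝓘(ℝ, ℝ) f (γ t) : E →L[ℝ] ℝ).comp
    (mfderivWithin 𝓘(ℝ, ℝ) 𝓘(ℝ, E) γ (Icc 0 1) t : ℝ →L[ℝ] E)) h.hasFDerivWithinAt

variable [IsManifold 𝓘(ℝ, E) ∞ M]
  [IsContMDiffRiemannianBundle 𝓘(ℝ, E) ∞ E (fun x : M => TangentSpace 𝓘(ℝ, E) x)]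

/-- The velocity is itself parallel, so the transported gradient pairs with the final velocity as
the original does with the initial one; Cauchy–Schwarz bounds the remainder. -/
theorem IsGradLipschitzOn.inner_velocity_le {X : Set M} {L : ℝ} {Φ : M → ℝ}
    (hL : IsGradLipschitzOn E X L Φ) {x y : M} (hx : x ∈ X) (hy : y ∈ X) {γ : ℝ → M}
    (h : IsGeodesicIn E X x y γ) :
    inner ℝ (grad (E := E) Φ (γ 1)) (velocity γ 1) ≤
      inner ℝ (grad (E := E) Φ (γ 0)) (velocity γ 0) + L * (edist x y).toReal ^ 2 := by
  obtain ⟨v, ⟨V, hV, hV0, hV1⟩, hv⟩ := hL x hx y hy γ h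
  have h1 := hV.inner_eq h.minGeodesic.mdifferentiableOn.continuousOn h.minGeodesic.geodesic
  rw [hV0, hV1] at h1
  have h2 : inner ℝ (grad (E := E) Φ (γ 1) - v) (velocity γ 1) ≤ L * (edist x y).toReal ^ 2 := by
    refine (real_inner_le_norm _ _).trans ?_
    have e : ‖velocity (E := E) γ 1‖ = (edist x y).toReal := by
      rw [h.minGeodesic.norm_velocity (right_mem_Icc.2 zero_le_one), h.source, h.target]
    rw [e, sq, ← mul_assoc]
    exact mul_le_mul_of_nonneg_right hv ENNReal.toReal_nonneg
  rw [inner_sub_left] at h2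
  linarith

variable [IsRiemannianManifold 𝓘(ℝ, E) M]

theorem IsGradLipschitzOn.apply_le {X : Set M} {L : ℝ} {Φ : M → ℝ}
    (hL : IsGradLipschitzOn E X L Φ) (hΦ : ∀ x ∈ X, MDifferentiableAt 𝓘(ℝ, E) 𝓘(ℝ, ℝ) Φ x)
    {x y : M} (hx : x ∈ X) {γ : ℝ → M} (h : IsGeodesicIn E X x y γ) {τ : ℝ}
    (hτ : τ ∈ Icc (0 : ℝ) 1) :
    Φ (γ τ) ≤ Φ (γ 0) + τ * inner ℝ (grad (E := E) Φ (γ 0)) (velocity γ 0)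
      + L / 2 * τ ^ 2 * (edist x y).toReal ^ 2 := by
  set q : ℝ → ℝ := fun t => inner ℝ (grad (E := E) Φ (γ t)) (velocity γ t) with hq
  set d := (edist x y).toReal
  have hder : ∀ t ∈ Icc (0 : ℝ) 1, HasDerivWithinAt (fun s => Φ (γ s)) (q t) (Icc 0 1) t :=
    fun t ht => hasDerivWithinAt_comp_curve (hΦ _ (h.mapsTo ht)) (h.minGeodesic.mdifferentiableOn t ht)
  -- The Lipschitz bound is applied to the arc up to time `t`, whose velocity and length carry a
  -- factor `t`; that factor is then divided out.
  have hq_le : ∀ t ∈ Icc (0 : ℝ) 1, 0 < t → q t ≤ q 0 + L * t * d ^ 2 := by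
    intro t ht ht0
    have hle := hL.inner_velocity_le hx (h.mapsTo ht) (h.comp_mul ht)
    rw [velocity_comp_mul h.minGeodesic.mdifferentiableOn ht (right_mem_Icc.2 zero_le_one),
      velocity_comp_mul h.minGeodesic.mdifferentiableOn ht (left_mem_Icc.2 zero_le_one),
      inner_smul_right, inner_smul_right] at hle
    -- Folding into `q` lets the time be rewritten in the base point and the vector at once.
    have e1 : inner ℝ (grad (E := E) Φ (γ (t * 1))) (velocity γ (t * 1)) = q t := by
      change q (t * 1) = q t
      rw [mul_one]
    have e0 : inner ℝ (grad (E := E) Φ (γ (t * 0))) (velocity γ (t * 0)) = q 0 := by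
      change q (t * 0) = q 0
      rw [mul_zero]
    have ed : (edist x (γ t)).toReal = t * d := by
      have := h.minGeodesic.edist_eq ht
      rw [h.source, h.target] at this
      rw [this, ENNReal.toReal_mul, ENNReal.toReal_ofReal ht.1]
    rw [e1, e0, ed] at hle
    refine le_of_mul_le_mul_left ?_ ht0
    linarith
  -- The sign of the derivative replaces integration of `q`, so no integrability of `q` is required.
  have hanti : AntitoneOn (fun t => Φ (γ t) - (t * q 0 + L / 2 * t ^ 2 * d ^ 2)) (Icc 0 1) := by
    have hd : ∀ t ∈ Icc (0 : ℝ) 1,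
        HasDerivWithinAt (fun t => Φ (γ t) - (t * q 0 + L / 2 * t ^ 2 * d ^ 2))
          (q t - (q 0 + L * t * d ^ 2)) (Icc 0 1) t := by
      intro t ht
      refine (hder t ht).sub (HasDerivAt.hasDerivWithinAt ?_)
      have := ((hasDerivAt_id t).mul_const (q 0)).add
        ((((hasDerivAt_id t).pow 2).const_mul (L / 2)).mul_const (d ^ 2))
      refine this.congr_deriv ?_
      push_cast
      simp only [id]
      ring
    refine antitoneOn_of_hasDerivWithinAt_nonpos (convex_Icc 0 1)
      (f' := fun t => q t - (q 0 + L * t * d ^ 2))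
      (fun t ht => (hd t ht).continuousWithinAt)
      (fun t ht => (hd t (interior_subset ht)).mono interior_subset) fun t ht => ?_
    rw [interior_Icc] at ht
    linarith [hq_le t (Ioo_subset_Icc_self ht) ht.1]
  have := hanti (left_mem_Icc.2 zero_le_one) hτ hτ.1
  simp only [zero_mul, zero_pow two_ne_zero, mul_zero, add_zero, sub_zero] at this
  linarith

/-- The descent inequality along the geodesics of `X`, common to both notions of smoothness. -/
theorem IsLSmoothOn.apply_le {X : Set M} (hX : IsGeodesicallyConvex E X) {L : ℝ} {Φ : M → ℝ}
    (hL : IsLSmoothOn E X L Φ) {x y : M} (hx : x ∈ X) (hy : y ∈ X) {γ : ℝ → M}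
    (h : IsGeodesicIn E X x y γ) {τ : ℝ} (hτ : τ ∈ Icc (0 : ℝ) 1) :
    Φ (γ τ) ≤ Φ x + τ * inner ℝ (grad (E := E) Φ x) (expInv X x y)
      + L / 2 * τ ^ 2 * (edist x y).toReal ^ 2 := by
  have e0 : inner ℝ (grad (E := E) Φ x) (expInv X x y) =
      inner ℝ (grad (E := E) Φ (γ 0)) (velocity γ 0) :=
    inner_grad_congr Φ (h.mk_expInv hX hx hy)
  obtain ⟨hdiff, hL | hL⟩ := hL
  · have := hL.apply_le hdiff hx h hτ
    have hs : Φ (γ 0) = Φ x := by rw [h.source]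
    rw [e0, ← hs]
    exact this
  -- The quadratic bound is used at the endpoint `γ τ`: there `Exp_x⁻¹` and the distance are `τ`
  -- times those of `y`.
  · have h1 := hL x hx (γ τ) (h.mapsTo hτ)
    have e1 : inner ℝ (grad (E := E) Φ x) (expInv X x (γ τ)) =
        τ * inner ℝ (grad (E := E) Φ (γ 0)) (velocity γ 0) := by
      refine (inner_grad_congr Φ
        ((h.comp_mul hτ).mk_expInv hX hx (h.mapsTo hτ))).trans ?_
      rw [velocity_comp_mul h.minGeodesic.mdifferentiableOn hτ (left_mem_Icc.2 zero_le_one),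
        inner_smul_right]
      congr 1
      change (fun t => inner ℝ (grad (E := E) Φ (γ t)) (velocity γ t)) (τ * 0) = _
      rw [mul_zero]
    have ed : (edist x (γ τ)).toReal = τ * (edist x y).toReal := by
      have := h.minGeodesic.edist_eq hτ
      rw [h.source, h.target] at this
      rw [this, ENNReal.toReal_mul, ENNReal.toReal_ofReal hτ.1]
    rw [e1, ed] at h1
    rw [e0]
    linarith

end Gradient

/-! ### Mean error of an i.i.d. average of bounded vectors. -/

section Variance

variable {H : Type*} [NormedAddCommGroup H] [InnerProductSpace ℝ H] [FiniteDimensional ℝ H]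
  {Ξ : Type*} [MeasurableSpace Ξ] {P : Measure Ξ} [IsProbabilityMeasure P]

theorem memLp_of_norm_le {F : Type*} [NormedAddCommGroup F] {Z : Ξ → F} (hZ : StronglyMeasurable Z)
    {C : ℝ} (hC : ∀ᵐ ξ ∂P, ‖Z ξ‖ ≤ C) (p : ℝ≥0∞) : MemLp Z p P :=
  MemLp.of_bound hZ.aestronglyMeasurable C hC

/-- The variance of the sum of `b` independent copies of a bounded random vector is at most `b`
times the square of the bound. -/
theorem integral_norm_sum_sub_sq_le {Z : Ξ → H} (hZ : StronglyMeasurable Z) {C : ℝ}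
    (hC : ∀ᵐ ξ ∂P, ‖Z ξ‖ ≤ C) (b : ℕ) :
    ∫ ξ : Fin b → Ξ, ‖∑ i, Z (ξ i) - (b : ℝ) • ∫ ζ, Z ζ ∂P‖ ^ 2 ∂(Measure.pi fun _ => P)
      ≤ b * C ^ 2 := by
  have : CompleteSpace H := FiniteDimensional.complete ℝ H
  set e := stdOrthonormalBasis ℝ H
  set m := ∫ ζ, Z ζ ∂P with hm
  have hZi : Integrable Z P := memLp_one_iff_integrable.1 (memLp_of_norm_le hZ hC 1)
  have hY : ∀ k, MemLp (fun ζ => inner ℝ (e k) (Z ζ)) 2 P := fun k =>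
    (memLp_of_norm_le hZ hC 2).const_inner (e k)
  have hS : ∀ k, MemLp (∑ i : Fin b, fun ξ : Fin b → Ξ => inner ℝ (e k) (Z (ξ i))) 2
      (Measure.pi fun _ => P) := fun k =>
    memLp_finsetSum' _ fun i _ => (hY k).comp_measurePreserving (measurePreserving_eval _ i)
  have hmean : ∀ k, ∫ ξ, (∑ i : Fin b, fun ξ : Fin b → Ξ => inner ℝ (e k) (Z (ξ i))) ξ
      ∂(Measure.pi fun _ => P) = b * inner ℝ (e k) m := by
    intro k
    simp only [Finset.sum_apply]
    rw [integral_finsetSum]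
    · have : ∀ i : Fin b, ∫ ξ : Fin b → Ξ, inner ℝ (e k) (Z (ξ i)) ∂(Measure.pi fun _ => P)
          = inner ℝ (e k) m := by
        intro i
        rw [hm, ← integral_inner hZi]
        exact integral_comp_eval (μ := fun _ : Fin b => P) (i := i)
          (f := fun ζ => inner ℝ (e k) (Z ζ)) (hY k).aestronglyMeasurable
      simp [this]
    · intro i _
      exact ((hY k).comp_measurePreserving (measurePreserving_eval _ i)).integrable (by simp)
  -- Splitting along an orthonormal basis reduces to additivity of scalar variances; the second
  -- moments of the coordinates later recombine into that of `‖Z‖`.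
  have hsq : ∀ ξ : Fin b → Ξ, ‖∑ i, Z (ξ i) - (b : ℝ) • m‖ ^ 2 =
      ∑ k, ((∑ i : Fin b, fun ξ : Fin b → Ξ => inner ℝ (e k) (Z (ξ i))) ξ
        - b * inner ℝ (e k) m) ^ 2 := by
    intro ξ
    rw [← e.sum_sq_norm_inner_right]
    refine Finset.sum_congr rfl fun k _ => ?_
    rw [inner_sub_right, inner_sum, inner_smul_right, Real.norm_eq_abs, sq_abs, Finset.sum_apply]
  simp only [hsq]
  have hint : ∀ k, Integrable (fun ξ => ((∑ i : Fin b, fun ξ : Fin b → Ξ =>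
      inner ℝ (e k) (Z (ξ i))) ξ - b * inner ℝ (e k) m) ^ 2) (Measure.pi fun _ => P) :=
    fun k => ((hS k).sub (memLp_const _)).integrable_sq
  rw [integral_finsetSum _ fun k _ => hint k]
  have hvar : ∀ k, ∫ ξ, ((∑ i : Fin b, fun ξ : Fin b → Ξ => inner ℝ (e k) (Z (ξ i))) ξ
        - b * inner ℝ (e k) m) ^ 2 ∂(Measure.pi fun _ => P) ≤ b * ∫ ζ, inner ℝ (e k) (Z ζ) ^ 2 ∂P := by
    intro k
    rw [← hmean k, ← variance_eq_integral (hS k).aemeasurable,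
      variance_sum_pi (X := fun (_ : Fin b) ζ => inner ℝ (e k) (Z ζ)) fun _ => hY k]
    simp only [Finset.sum_const, Finset.card_univ, Fintype.card_fin, nsmul_eq_mul]
    gcongr
    exact variance_le_expectation_sq (hY k).aestronglyMeasurable
  refine (Finset.sum_le_sum fun k _ => hvar k).trans ?_
  rw [← Finset.mul_sum, ← integral_finsetSum _ fun k _ => (hY k).integrable_sq]
  gcongr
  have hle : ∀ᵐ ζ ∂P, ∑ k, inner ℝ (e k) (Z ζ) ^ 2 ≤ C ^ 2 := by
    filter_upwards [hC] with ζ hζ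
    have := e.sum_sq_norm_inner_right (Z ζ)
    simp only [Real.norm_eq_abs, sq_abs] at this
    rw [this]
    gcongr
  have := integral_mono_ae (integrable_finsetSum _ fun k _ => (hY k).integrable_sq)
    (integrable_const (C ^ 2)) hle
  simpa using this

/-- The mean of `b` independent copies of a bounded random vector is within `C / √b` of the
expectation, in mean. -/
theorem lintegral_norm_mean_sub_le {Z : Ξ → H} (hZ : StronglyMeasurable Z) {C : ℝ}
    (hC : ∀ᵐ ξ ∂P, ‖Z ξ‖ ≤ C) {b : ℕ} (hb : 0 < b) :
    ∫⁻ ξ : Fin b → Ξ, ENNReal.ofReal ‖(1 / (b : ℝ)) • ∑ i, Z (ξ i) - ∫ ζ, Z ζ ∂P‖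
      ∂(Measure.pi fun _ => P) ≤ ENNReal.ofReal (|C| / √(b : ℝ)) := by
  have hb' : (0 : ℝ) < b := by exact_mod_cast hb
  set m := ∫ ζ, Z ζ ∂P
  set f : (Fin b → Ξ) → ℝ := fun ξ => ‖(1 / (b : ℝ)) • ∑ i, Z (ξ i) - m‖ with hf
  have hfm : MemLp f 2 (Measure.pi fun _ => P) := by
    refine (MemLp.sub ?_ (memLp_const m)).norm
    refine MemLp.const_smul ?_ _
    exact memLp_finsetSum _ fun i _ =>
      (memLp_of_norm_le hZ hC 2).comp_measurePreserving (measurePreserving_eval _ i)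
  rw [← ofReal_integral_eq_lintegral_ofReal (hfm.integrable (by simp))
    (Eventually.of_forall fun _ => norm_nonneg _)]
  refine ENNReal.ofReal_le_ofReal ?_
  have h2 : ∫ ξ, f ξ ^ 2 ∂(Measure.pi fun _ => P) ≤ C ^ 2 / b := by
    have h := integral_norm_sum_sub_sq_le hZ hC b
    have hfe : ∀ ξ, f ξ ^ 2 = (1 / (b : ℝ)) ^ 2 * ‖∑ i, Z (ξ i) - (b : ℝ) • m‖ ^ 2 := by
      intro ξ
      have : (1 / (b : ℝ)) • ∑ i, Z (ξ i) - m =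
          (1 / (b : ℝ)) • (∑ i, Z (ξ i) - (b : ℝ) • m) := by
        rw [smul_sub, smul_smul, one_div_mul_cancel hb'.ne', one_smul]
      rw [hf]
      beta_reduce
      rw [this, norm_smul, mul_pow, Real.norm_eq_abs, sq_abs]
    simp only [hfe]
    rw [integral_const_mul]
    calc (1 / (b : ℝ)) ^ 2 * _ ≤ (1 / (b : ℝ)) ^ 2 * (b * C ^ 2) := by gcongr
      _ = C ^ 2 / b := by field_simp
  -- Nonnegative variance is the inequality `(E f)² ≤ E f²`, which passes from mean square to mean.
  have hv := variance_nonneg f (Measure.pi fun _ : Fin b => P)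
  rw [variance_eq_sub hfm] at hv
  have h3 : (∫ ξ, f ξ ∂(Measure.pi fun _ => P)) ^ 2 ≤ (|C| / √(b : ℝ)) ^ 2 := by
    rw [div_pow, sq_abs, Real.sq_sqrt hb'.le]
    refine le_trans ?_ h2
    simpa using hv
  exact le_of_sq_le_sq h3 (by positivity)

end Variance

/-! ### Measurable coordinates on the tangent bundle. -/

section Coordinates

variable {E : Type*} [NormedAddCommGroup E] [NormedSpace ℝ E]
  {M : Type*} [EMetricSpace M] [ChartedSpace E M]

/-- The coordinates of a tangent vector in the preferred chart at `p`, extended by zero outside of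
the domain of this chart. -/
noncomputable def tangentCoord (p : M) (x : M) (v : TangentSpace 𝓘(ℝ, E) x) : E :=
  (chartAt E p).source.indicator
    (fun y => (mfderiv 𝓘(ℝ, E) 𝓘(ℝ, E) (chartAt E p) y : E →L[ℝ] E) v) x

theorem tangentCoord_of_mem {p x : M} (hx : x ∈ (chartAt E p).source) (v : TangentSpace 𝓘(ℝ, E) x) :
    tangentCoord p x v = (mfderiv 𝓘(ℝ, E) 𝓘(ℝ, E) (chartAt E p) x v : E) :=
  indicator_of_mem hx _

theorem tangentCoord_of_notMem {p x : M} (hx : x ∉ (chartAt E p).source)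
    (v : TangentSpace 𝓘(ℝ, E) x) : tangentCoord p x v = 0 :=
  indicator_of_notMem hx _

variable [IsManifold 𝓘(ℝ, E) ∞ M]

/-- Over the chart domain these coordinates are the fibre component of the bundle trivialization at
`p`. -/
theorem continuousOn_tangentCoord (p : M) :
    ContinuousOn (fun z : TangentBundle 𝓘(ℝ, E) M => tangentCoord p z.1 z.2)
      (TotalSpace.proj ⁻¹' (chartAt E p).source) := by
  have : IsManifold 𝓘(ℝ, E) 1 M := IsManifold.of_le (n := ∞) (by simp)
  have h := (trivializationAt E (TangentSpace 𝓘(ℝ, E)) p).continuousOn_toFun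
  have h2 : ContinuousOn (fun z => ((trivializationAt E (TangentSpace 𝓘(ℝ, E)) p) z).2)
    (trivializationAt E (TangentSpace 𝓘(ℝ, E)) p).source := continuous_snd.comp_continuousOn h
  rw [(trivializationAt E (TangentSpace 𝓘(ℝ, E)) p).source_eq] at h2
  refine h2.congr fun z hz => ?_
  have hz' : z.1 ∈ (chartAt E p).source := hz
  have h3 := TangentBundle.continuousLinearMapAt_trivializationAt (I := 𝓘(ℝ, E)) hz'
  have h4 := congrArg (fun A : E →L[ℝ] E => A z.2) h3
  beta_reduce
  rw [tangentCoord_of_mem hz']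
  refine Eq.trans ?_ (h4.symm.trans ?_)
  · simp [mfld_simps]
    rfl
  · exact (trivializationAt E (TangentSpace 𝓘(ℝ, E)) p).continuousLinearMapAt_apply_of_mem ℝ hz' _

theorem measurable_tangentCoord [MeasurableSpace E] [BorelSpace E] (p : M) :
    Measurable[borel _] (fun z : TangentBundle 𝓘(ℝ, E) M => tangentCoord p z.1 z.2) := by
  let _ : MeasurableSpace (TangentBundle 𝓘(ℝ, E) M) := borel _
  have : BorelSpace (TangentBundle 𝓘(ℝ, E) M) := ⟨rfl⟩
  classical
  have hs : IsOpen (TotalSpace.proj ⁻¹' (chartAt E p).source : Set (TangentBundle 𝓘(ℝ, E) M)) :=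
    (chartAt E p).open_source.preimage (FiberBundle.continuous_proj E _)
  have h := (continuousOn_tangentCoord (E := E) p).measurable_piecewise
    (g := fun _ => (0 : E)) continuousOn_const hs.measurableSet
  convert h using 1
  ext z
  by_cases hz : z ∈ (TotalSpace.proj ⁻¹' (chartAt E p).source : Set (TangentBundle 𝓘(ℝ, E) M))
  · rw [piecewise_eq_of_mem _ _ _ hz]
  · rw [piecewise_eq_of_notMem _ _ _ hz]
    exact tangentCoord_of_notMem hz _

theorem mfderiv_symm_tangentCoord_self (x : M) (v : TangentSpace 𝓘(ℝ, E) x) :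
    (mfderiv 𝓘(ℝ, E) 𝓘(ℝ, E) (chartAt E x).symm (chartAt E x x)
      (tangentCoord (E := E) x x v) : E) = v := by
  rw [tangentCoord_of_mem (mem_chart_source E x)]
  exact mfderiv_chartAt_symm_mfderiv_chartAt x (mem_chart_source E x) v

variable [RiemannianBundle (fun x : M => TangentSpace 𝓘(ℝ, E) x)]

theorem norm_eq_sqrt_metricForm {p x : M} (hx : x ∈ (chartAt E p).source)
    (v : TangentSpace 𝓘(ℝ, E) x) :
    ‖v‖ = √(metricForm p (chartAt E p x) (tangentCoord p x v) (tangentCoord p x v)) := by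
  rw [tangentCoord_of_mem hx, norm_eq_sqrt_real_inner]
  exact congrArg _ (inner_eq_metricInChart p hx v v)

theorem measurable_indicator_metricForm [FiniteDimensional ℝ E]
    [IsContMDiffRiemannianBundle 𝓘(ℝ, E) ∞ E (fun x : M => TangentSpace 𝓘(ℝ, E) x)]
    [MeasurableSpace E] [BorelSpace E] [MeasurableSpace M] [BorelSpace M] (p : M) :
    Measurable (((chartAt E p).source ×ˢ univ).indicator
      fun q : M × E => √(metricForm (E := E) p (chartAt E p q.1) q.2 q.2)) := by
  classical
  rw [← piecewise_eq_indicator]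
  refine ContinuousOn.measurable_piecewise ?_ continuousOn_const
    ((chartAt E p).open_source.prod isOpen_univ).measurableSet
  refine Real.continuous_sqrt.comp_continuousOn ?_
  have h1 : ContinuousOn (fun q : M × E => metricForm (E := E) p (chartAt E p q.1))
      ((chartAt E p).source ×ˢ univ) := by
    refine (contDiffOn_metricForm p).continuousOn.comp
      ((chartAt E p).continuousOn.comp continuousOn_fst fun q hq => hq.1) fun q hq => ?_
    exact (chartAt E p).map_source hq.1
  exact (h1.clm_apply continuousOn_snd).clm_apply continuousOn_snd

end Coordinates

/-! ### Measurability and size of the minibatch error. -/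

section StochasticGradient

variable {E : Type*} [NormedAddCommGroup E] [NormedSpace ℝ E]
  {M : Type*} [EMetricSpace M] [ChartedSpace E M]

theorem exists_continuousLinearMap_tangentCoord (p x : M) :
    ∃ A : TangentSpace 𝓘(ℝ, E) x →L[ℝ] E, ∀ v, tangentCoord p x v = A v := by
  by_cases hx : x ∈ (chartAt E p).source
  · exact ⟨(mfderiv 𝓘(ℝ, E) 𝓘(ℝ, E) (chartAt E p) x : TangentSpace 𝓘(ℝ, E) x →L[ℝ] E),
      fun v => tangentCoord_of_mem hx v⟩
  · exact ⟨0, fun v => tangentCoord_of_notMem hx v⟩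

theorem tangentCoord_sub (p x : M) (v w : TangentSpace 𝓘(ℝ, E) x) :
    tangentCoord p x (v - w) = tangentCoord p x v - tangentCoord (E := E) p x w := by
  obtain ⟨A, hA⟩ := exists_continuousLinearMap_tangentCoord (E := E) p x
  simp only [hA, map_sub]

variable [FiniteDimensional ℝ E] [RiemannianBundle (fun x : M => TangentSpace 𝓘(ℝ, E) x)]

variable (E) in
/-- The coordinates of the gradient of `f` in the preferred chart at `p`. -/
noncomputable def gradCoord (p : M) (f : M → ℝ) (x : M) : E := tangentCoord p x (grad f x)

theorem tangentCoord_batchGrad {Ξ : Type*} (φ : M → Ξ → ℝ) (p x : M) {b : ℕ} (ξ : Fin b → Ξ) :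
    tangentCoord (E := E) p x (batchGrad φ ξ x) =
      (1 / (b : ℝ)) • ∑ i, gradCoord E p (fun z => φ z (ξ i)) x := by
  obtain ⟨A, hA⟩ := exists_continuousLinearMap_tangentCoord (E := E) p x
  simp only [gradCoord, hA, batchGrad, map_smul, map_sum]

variable (E) in
/-- The error of the minibatch gradient. -/
noncomputable def batchError {Ξ : Type*} (φ : M → Ξ → ℝ) (Φ : M → ℝ) {b : ℕ} (ξ : Fin b → Ξ) (x : M) : ℝ :=
  ‖batchGrad (E := E) φ ξ x - grad Φ x‖

variable [IsManifold 𝓘(ℝ, E) ∞ M]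

theorem batchError_eq {Ξ : Type*} (φ : M → Ξ → ℝ) (Φ : M → ℝ) {p x : M} (hx : x ∈ (chartAt E p).source) {b : ℕ} (ξ : Fin b → Ξ) :
    batchError E φ Φ ξ x = ((chartAt E p).source ×ˢ univ).indicator
      (fun q : M × E => √(metricForm (E := E) p (chartAt E p q.1) q.2 q.2))
      (x, (1 / (b : ℝ)) • ∑ i, gradCoord E p (fun z => φ z (ξ i)) x - gradCoord E p Φ x) := by
  rw [batchError, norm_eq_sqrt_metricForm hx, indicator_of_mem (mk_mem_prod hx (mem_univ _)),
    tangentCoord_sub, tangentCoord_batchGrad]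
  rfl

variable [MeasurableSpace M] {Ξ : Type*} [MeasurableSpace Ξ]
  {X : Set M} {φ : M → Ξ → ℝ}

theorem MeasurableGradOn.measurable_gradCoord [MeasurableSpace E] [BorelSpace E]
    (h : MeasurableGradOn E X φ) (p : M) :
    Measurable fun q : X × Ξ => gradCoord E p (fun z => φ z q.2) (q.1 : M) :=
  @Measurable.comp _ _ _ _ (borel (TangentBundle 𝓘(ℝ, E) M)) _ _ _ (measurable_tangentCoord p) h

/-- With `x` fixed, the gradient is recovered from its measurable coordinates by one continuous
linear map. -/
theorem MeasurableGradOn.stronglyMeasurable (h : MeasurableGradOn E X φ) {x : M} (hx : x ∈ X) :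
    StronglyMeasurable fun ξ => (grad (fun z => φ z ξ) x : TangentSpace 𝓘(ℝ, E) x) := by
  borelize E
  have h0 := (h.measurable_gradCoord x).comp (measurable_prodMk_left (x := (⟨x, hx⟩ : X)))
  have h1 : Measurable fun ξ => gradCoord E x (fun z => φ z ξ) x := h0
  have key : ∀ (B : E →L[ℝ] E) (g : Ξ → E), (∀ ξ, B (gradCoord E x (fun z => φ z ξ) x) = g ξ) →
      StronglyMeasurable g := fun B g hg => by
    rw [← funext hg]
    exact B.continuous.comp_stronglyMeasurable h1.stronglyMeasurable
  exact key (mfderiv 𝓘(ℝ, E) 𝓘(ℝ, E) (chartAt E x).symm (chartAt E x x)) _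
    fun ξ => mfderiv_symm_tangentCoord_self x _

variable {P : Measure Ξ} [IsProbabilityMeasure P]

theorem MeasurableGradOn.gradCoord_eq_integral (h : MeasurableGradOn E X φ) {x : M} (hx : x ∈ X)
    {f : M → ℝ} (hunbiased : ∫ ξ, grad (E := E) (fun z => φ z ξ) x ∂P = grad (E := E) f x)
    {C : ℝ} (hC : ∀ᵐ ξ ∂P, ‖grad (E := E) (fun z => φ z ξ) x‖ ≤ C) (p : M) :
    gradCoord E p f x = ∫ ξ, gradCoord E p (fun z => φ z ξ) x ∂P := by
  have : FiniteDimensional ℝ (TangentSpace 𝓘(ℝ, E) x) := inferInstanceAs (FiniteDimensional ℝ E)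
  have : CompleteSpace (TangentSpace 𝓘(ℝ, E) x) := FiniteDimensional.complete ℝ _
  have : CompleteSpace E := FiniteDimensional.complete ℝ _
  obtain ⟨A, hA⟩ := exists_continuousLinearMap_tangentCoord (E := E) p x
  have hint : Integrable (fun ξ => grad (E := E) (fun z => φ z ξ) x) P :=
    Integrable.of_bound (h.stronglyMeasurable hx).aestronglyMeasurable C hC
  simp only [gradCoord, hA]
  rw [← hunbiased]
  exact (A.integral_comp_comm hint).symm

/-- Unbiasedness presents these coordinates as an integral depending on a parameter, hence
measurable without any continuity of the gradient of `Φ`. -/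
theorem MeasurableGradOn.measurable_gradCoord_expectation [MeasurableSpace E] [BorelSpace E]
    (h : MeasurableGradOn E X φ) {Φ : M → ℝ}
    (hunbiased : ∀ x ∈ X, ∫ ξ, grad (E := E) (fun z => φ z ξ) x ∂P = grad (E := E) Φ x)
    {C : ℝ} (hC : ∀ x ∈ X, ∀ᵐ ξ ∂P, ‖grad (E := E) (fun z => φ z ξ) x‖ ≤ C) (p : M) :
    Measurable fun x : X => gradCoord E p Φ (x : M) := by
  have h1 := (h.measurable_gradCoord p).stronglyMeasurable.integral_prod_right' (ν := P)
  have h2 : (fun x : X => gradCoord E p Φ (x : M)) =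
      fun x : X => ∫ ξ, gradCoord E p (fun z => φ z ξ) (x : M) ∂P :=
    funext fun x => h.gradCoord_eq_integral x.2 (hunbiased x x.2) (hC x x.2) p
  rw [h2]
  exact h1.measurable

theorem MeasurableGradOn.lintegral_batchError_le (h : MeasurableGradOn E X φ) {Φ : M → ℝ} {x : M}
    (hx : x ∈ X) (hunbiased : ∫ ξ, grad (E := E) (fun z => φ z ξ) x ∂P = grad (E := E) Φ x)
    {C : ℝ} (hC : ∀ᵐ ξ ∂P, ‖grad (E := E) (fun z => φ z ξ) x‖ ≤ C) {b : ℕ} (hb : 0 < b) :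
    ∫⁻ ξ : Fin b → Ξ, ENNReal.ofReal (batchError E φ Φ ξ x) ∂(Measure.pi fun _ => P)
      ≤ ENNReal.ofReal (|C| / √(b : ℝ)) := by
  have : FiniteDimensional ℝ (TangentSpace 𝓘(ℝ, E) x) := inferInstanceAs (FiniteDimensional ℝ E)
  have h1 := lintegral_norm_mean_sub_le (h.stronglyMeasurable hx) hC hb
  rw [hunbiased] at h1
  exact h1

variable [BorelSpace M]
  [IsContMDiffRiemannianBundle 𝓘(ℝ, E) ∞ E (fun x : M => TangentSpace 𝓘(ℝ, E) x)]

theorem MeasurableGradOn.measurable_batchError (hX : IsCompact X)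
    (h : MeasurableGradOn E X φ) {Φ : M → ℝ}
    (hunbiased : ∀ x ∈ X, ∫ ξ, grad (E := E) (fun z => φ z ξ) x ∂P = grad (E := E) Φ x)
    {C : ℝ} (hC : ∀ x ∈ X, ∀ᵐ ξ ∂P, ‖grad (E := E) (fun z => φ z ξ) x‖ ≤ C) (b : ℕ) :
    Measurable fun q : X × (Fin b → Ξ) => batchError E φ Φ q.2 (q.1 : M) := by
  borelize E
  -- The error has a measurable formula only chart by chart; a finite cover makes each preimage a
  -- finite union.
  obtain ⟨t, -, ht⟩ := hX.elim_nhds_subcover (fun p => (chartAt E p).source)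
    fun p _ => (chartAt E p).open_source.mem_nhds (mem_chart_source E p)
  have hfst : Measurable (Prod.fst : X × (Fin b → Ξ) → X) := measurable_fst
  have hsnd : Measurable (Prod.snd : X × (Fin b → Ξ) → Fin b → Ξ) := measurable_snd
  have hcoord : ∀ p : M, Measurable fun q : X × (Fin b → Ξ) =>
      (1 / (b : ℝ)) • ∑ i, gradCoord E p (fun z => φ z (q.2 i)) (q.1 : M)
        - gradCoord E p Φ (q.1 : M) := by
    intro p
    have h1 := (h.measurable_gradCoord_expectation hunbiased hC p).comp hfst
    have h2 := fun i : Fin b => (h.measurable_gradCoord p).comp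
      (hfst.prodMk ((measurable_pi_apply i).comp hsnd))
    exact ((Finset.measurable_fun_sum _ fun i _ => h2 i).const_smul _).sub h1
  have hloc := fun p : M => (measurable_indicator_metricForm (E := E) p).comp
    ((measurable_subtype_coe.comp hfst).prodMk (hcoord p))
  have hsrc : ∀ p : M, MeasurableSet {q : X × (Fin b → Ξ) | (q.1 : M) ∈ (chartAt E p).source} :=
    fun p => (measurable_subtype_coe.comp hfst) (chartAt E p).open_source.measurableSet
  intro s hs
  have hunion : (fun q : X × (Fin b → Ξ) => batchError E φ Φ q.2 (q.1 : M)) ⁻¹' s = ⋃ p ∈ t,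
      ({q : X × (Fin b → Ξ) | (q.1 : M) ∈ (chartAt E p).source} ∩
        (fun q : X × (Fin b → Ξ) => batchError E φ Φ q.2 (q.1 : M)) ⁻¹' s) := by
    ext q
    simp only [mem_preimage, mem_iUnion, mem_inter_iff, mem_ofPred_eq, exists_prop]
    constructor
    · intro hq
      obtain ⟨p, hp, hqp⟩ := mem_iUnion₂.1 (ht q.1.2)
      exact ⟨p, hp, hqp, hq⟩
    · rintro ⟨p, hp, hqp, hq⟩
      exact hq
  rw [hunion]
  refine Finset.measurableSet_biUnion _ fun p _ => ?_
  convert (hsrc p).inter (hloc p hs) using 1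
  ext q
  simp only [mem_preimage, mem_inter_iff, mem_ofPred_eq]
  refine and_congr_right fun hq => ?_
  rw [batchError_eq φ Φ hq]
  rfl

end StochasticGradient

/-! ### The Frank–Wolfe gap. -/

section Gap

variable {E : Type*} [NormedAddCommGroup E] [NormedSpace ℝ E] [FiniteDimensional ℝ E]
  {M : Type*} [EMetricSpace M] [ChartedSpace E M]
  [RiemannianBundle (fun x : M => TangentSpace 𝓘(ℝ, E) x)]
  {X : Set M} (hconv : IsGeodesicallyConvex E X) {D : ℝ}
  (hD : ∀ x ∈ X, ∀ y ∈ X, (edist x y).toReal ≤ D) (Φ : M → ℝ) {x : M} (hx : x ∈ X)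

include hconv hD hx

/-- The point `x` itself competes with value `0`; the finite diameter bounds the family, as
comparison with a real supremum requires. -/
theorem fwGap_nonneg : 0 ≤ fwGap E X Φ x := by
  have hbdd : BddAbove (range fun y : X =>
      inner ℝ (expInv X x (y : M)) (-grad (E := E) Φ x)) := by
    refine ⟨D * ‖-grad (E := E) Φ x‖, ?_⟩
    rintro _ ⟨y, rfl⟩
    refine (real_inner_le_norm _ _).trans ?_
    rw [norm_expInv hconv hx y.2]
    exact mul_le_mul_of_nonneg_right (hD x hx y y.2) (norm_nonneg _)
  refine le_trans ?_ (le_ciSup hbdd ⟨x, hx⟩)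
  rw [expInv_self hconv hx, inner_zero_left]

/-- If `y` solves the linear subproblem for an approximation `g` of the gradient, the gap is
controlled by the decrease along `y` and the error of `g`. -/
theorem fwGap_le {y : M} (hy : y ∈ X) (g : TangentSpace 𝓘(ℝ, E) x)
    (hmin : ∀ z ∈ X, inner ℝ g (expInv X x y) ≤ inner ℝ g (expInv X x z)) :
    fwGap E X Φ x ≤ -inner ℝ (grad (E := E) Φ x) (expInv X x y) + 2 * D * ‖g - grad Φ x‖ := by
  have : Nonempty X := ⟨⟨x, hx⟩⟩
  refine ciSup_le fun z => ?_
  have h1 := hmin z z.2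
  have h2 : inner ℝ (g - grad (E := E) Φ x) (expInv X x (z : M) - expInv X x y) ≤
      2 * D * ‖g - grad Φ x‖ := by
    refine (real_inner_le_norm _ _).trans ?_
    rw [mul_comm]
    refine mul_le_mul_of_nonneg_right ((norm_sub_le _ _).trans ?_) (norm_nonneg _)
    rw [norm_expInv hconv hx z.2, norm_expInv hconv hx hy]
    linarith [hD x hx z z.2, hD x hx y hy]
  rw [inner_sub_left, inner_sub_right, inner_sub_right] at h2
  rw [inner_neg_right, real_inner_comm]
  linarith

end Gap

/-! ### One iteration of the algorithm. -/

section Run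

variable {E : Type*} [NormedAddCommGroup E] [NormedSpace ℝ E] [FiniteDimensional ℝ E]
  {M : Type*} [EMetricSpace M] [ChartedSpace E M]
  [RiemannianBundle (fun x : M => TangentSpace 𝓘(ℝ, E) x)]
  [MeasurableSpace M] {Ξ : Type*} [MeasurableSpace Ξ]
  {X : Set M} {φ : M → Ξ → ℝ} {P : Measure Ξ} {K : ℕ} {η : ℕ → ℝ} {b : ℕ → ℕ}
  {Ω : Type*} [mΩ : MeasurableSpace Ω] {μ : Measure Ω}

theorem Run.mem (R : Run E X φ P K η b μ) (hη : ∀ k, η k ∈ Icc (0 : ℝ) 1) {k : ℕ} (hk : k ≤ K)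
    (s : Ω) : R.x k s ∈ X := by
  cases k with
  | zero => exact R.init_mem s
  | succ k =>
    obtain ⟨γ, hγ, h⟩ := R.step k hk s
    rw [h]
    exact hγ.mapsTo (hη k)

theorem Run.measurable_state (R : Run E X φ P K η b μ) (hη : ∀ k, η k ∈ Icc (0 : ℝ) 1) {k : ℕ}
    (hk : k ≤ K) : Measurable[R.ℱ k] fun s => (⟨R.x k s, R.mem hη hk s⟩ : X) :=
  (R.adapted k hk).subtype_mk

theorem Run.measurable_batch (R : Run E X φ P K η b μ) {k : ℕ} (hk : k < K) :
    Measurable[R.ℱ (k + 1)] fun s i => R.ξ k i s :=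
  (@measurable_pi_iff _ _ _ (R.ℱ (k + 1)) _ _).2 fun i => R.sample_measurable k hk i

theorem Run.map_batch [IsProbabilityMeasure μ] (R : Run E X φ P K η b μ) {k : ℕ} (hk : k < K) :
    μ.map (fun s i => R.ξ k i s) = Measure.pi fun _ => P := by
  have h := (iIndepFun_iff_map_fun_eq_pi_map (μ := μ) (f := R.ξ k) fun i =>
    ((R.sample_measurable k hk i).mono (R.ℱ.le _) le_rfl).aemeasurable).1 (R.sample_indep k hk)
  rw [h]
  simp only [R.sample_law k hk]

theorem Run.indepFun_state_batch (R : Run E X φ P K η b μ) (hη : ∀ k, η k ∈ Icc (0 : ℝ) 1) {k : ℕ}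
    (hk : k < K) :
    IndepFun (fun s => (⟨R.x k s, R.mem hη hk.le s⟩ : X)) (fun s i => R.ξ k i s) μ := by
  have h := (R.batch_indep_past k hk).symm
  refine indep_of_indep_of_le_left (indep_of_indep_of_le_right h ?_) ?_
  · refine Measurable.comap_le ?_
    refine (@measurable_pi_iff _ _ _ (_) _ _).2 fun i => ?_
    exact (comap_measurable (R.ξ k i)).mono (le_iSup (fun i => MeasurableSpace.comap (R.ξ k i)
      inferInstance) i) le_rfl
  · exact (R.measurable_state hη hk.le).comap_le

variable [IsManifold 𝓘(ℝ, E) ∞ M]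
  [IsContMDiffRiemannianBundle 𝓘(ℝ, E) ∞ E (fun x : M => TangentSpace 𝓘(ℝ, E) x)]

/-- One iteration: the gap at `x_k` is bounded by the decrease of `Φ`, the error of the minibatch
gradient, and a curvature term. -/
theorem Run.mul_fwGap_le [IsRiemannianManifold 𝓘(ℝ, E) M] (hconv : IsGeodesicallyConvex E X)
    {D : ℝ} (hD : ∀ x ∈ X, ∀ y ∈ X, (edist x y).toReal ≤ D) {Φ : M → ℝ} {L : ℝ}
    (hL : IsLSmoothOn E X L Φ) (R : Run E X φ P K η b μ) (hη : ∀ k, η k ∈ Icc (0 : ℝ) 1) {k : ℕ}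
    (hk : k < K) (s : Ω) :
    η k * fwGap E X Φ (R.x k s) ≤ Φ (R.x k s) - Φ (R.x (k + 1) s)
      + η k * (2 * D * batchError E φ Φ (fun i => R.ξ k i s) (R.x k s))
      + η k ^ 2 * (|L| / 2 * D ^ 2) := by
  have hx := R.mem hη hk.le s
  have hy := R.oracle_mem k hk s
  obtain ⟨γ, hγ, h⟩ := R.step k hk s
  have h1 := hL.apply_le hconv hx hy hγ (hη k)
  rw [← h] at h1
  have h2 := mul_le_mul_of_nonneg_left
    (fwGap_le hconv hD Φ hx hy _ (R.oracle_min k hk s)) (hη k).1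
  -- The sign of `L` is not prescribed, so `|L|` is needed before enlarging the distance to `D`.
  have h3 : L / 2 * η k ^ 2 * (edist (R.x k s) (R.y k s)).toReal ^ 2 ≤
      η k ^ 2 * (|L| / 2 * D ^ 2) := by
    have := hD _ hx _ hy
    have h0 : 0 ≤ (edist (R.x k s) (R.y k s)).toReal := ENNReal.toReal_nonneg
    calc L / 2 * η k ^ 2 * (edist (R.x k s) (R.y k s)).toReal ^ 2
        ≤ |L| / 2 * η k ^ 2 * D ^ 2 := by
          gcongr
          exact le_abs_self L
      _ = _ := by ring
  rw [batchError]
  linarith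

variable [IsProbabilityMeasure P] [BorelSpace M]

section Error

variable (hX : IsCompact X) (hmeas : MeasurableGradOn E X φ) {Φ : M → ℝ}
  (hunbiased : ∀ x ∈ X, ∫ ξ, grad (E := E) (fun z => φ z ξ) x ∂P = grad (E := E) Φ x)
  {C : ℝ} (hC : ∀ x ∈ X, ∀ᵐ ξ ∂P, ‖grad (E := E) (fun z => φ z ξ) x‖ ≤ C)
  (R : Run E X φ P K η b μ) (hη : ∀ k, η k ∈ Icc (0 : ℝ) 1) {k : ℕ} (hk : k < K)

include hX hmeas hunbiased hC hη hk

theorem Run.measurable_batchError :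
    Measurable[R.ℱ (k + 1)] fun s => batchError E φ Φ (fun i => R.ξ k i s) (R.x k s) := by
  have h := hmeas.measurable_batchError hX hunbiased hC (b k)
  have h1 : Measurable[R.ℱ (k + 1)] fun s =>
      ((⟨R.x k s, R.mem hη hk.le s⟩ : X), fun i => R.ξ k i s) :=
    ((R.measurable_state hη hk.le).mono (R.ℱ.mono k.le_succ) le_rfl).prodMk (R.measurable_batch hk)
  have key : ∀ F : X × (Fin (b k) → Ξ) → ℝ, Measurable F → Measurable[R.ℱ (k + 1)] fun s =>
      F ((⟨R.x k s, R.mem hη hk.le s⟩ : X), fun i => R.ξ k i s) := fun F hF => hF.comp h1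
  exact key (fun q => batchError E φ Φ q.2 (q.1 : M)) h

theorem Run.lintegral_batchError_le [IsProbabilityMeasure μ] (hb : 0 < b k) :
    ∫⁻ s, ENNReal.ofReal (batchError E φ Φ (fun i => R.ξ k i s) (R.x k s)) ∂μ
      ≤ ENNReal.ofReal (|C| / √(b k : ℝ)) := by
  have h := (hmeas.measurable_batchError hX hunbiased hC (b k)).ennreal_ofReal
  have hx := (R.measurable_state hη hk.le).mono (R.ℱ.le _) le_rfl
  have hξ := (R.measurable_batch hk).mono (R.ℱ.le _) le_rfl
  -- The joint law of the state and the batch is a product, so Tonelli reduces the claim to a fixed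
  -- point of `X`.
  have hmap := (indepFun_iff_map_prod_eq_prod_map_map hx.aemeasurable hξ.aemeasurable).1
    (R.indepFun_state_batch hη hk)
  rw [R.map_batch hk] at hmap
  have h1 := lintegral_map (μ := μ) h (hx.prodMk hξ)
  rw [hmap] at h1
  refine h1.symm.le.trans ?_
  rw [lintegral_prod _ h.aemeasurable]
  have : IsProbabilityMeasure (μ.map fun s => (⟨R.x k s, R.mem hη hk.le s⟩ : X)) :=
    Measure.isProbabilityMeasure_map hx.aemeasurable
  refine (lintegral_mono fun x : X => hmeas.lintegral_batchError_le x.2 (hunbiased x x.2)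
    (hC x x.2) hb).trans ?_
  simp

end Error

end Run

/-! ### Averaging over the iterations. -/

section Convergence

variable {E : Type*} [NormedAddCommGroup E] [NormedSpace ℝ E] [FiniteDimensional ℝ E]
  {M : Type*} [EMetricSpace M] [ChartedSpace E M]
  [RiemannianBundle (fun x : M => TangentSpace 𝓘(ℝ, E) x)]
  [MeasurableSpace M] {Ξ : Type*} [MeasurableSpace Ξ]
  {X : Set M} {φ : M → Ξ → ℝ} {P : Measure Ξ} {K : ℕ}
  {Ω : Type*} [mΩ : MeasurableSpace Ω] {μ : Measure Ω}

/-- The returned index averages over the iterations. -/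
theorem Run.lintegral_index {η : ℕ → ℝ} {b : ℕ → ℕ} (R : Run E X φ P K η b μ)
    {f : Fin K → Ω → ℝ≥0∞} (hf : ∀ k, Measurable[R.ℱ K] (f k)) :
    ∫⁻ s, f (R.index s) s ∂μ = (∑ k, ∫⁻ s, f k s ∂μ) * (K : ℝ≥0∞)⁻¹ := by
  have hpre : ∀ k, MeasurableSet (R.index ⁻¹' {k}) := fun k =>
    R.index_measurable (measurableSet_singleton k)
  -- On each event `index = k` the integrand is an `ℱ K`-measurable function times an indicator
  -- independent of it, so the integral factors.
  have hsum : ∀ s, f (R.index s) s = ∑ k, f k s * (R.index ⁻¹' {k}).indicator 1 s := by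
    intro s
    rw [Finset.sum_eq_single (R.index s)]
    · simp
    · intro k _ hk
      rw [indicator_of_notMem (by simpa using hk.symm), mul_zero]
    · simp
  simp only [hsum]
  have hmul : ∀ k, Measurable fun s => f k s * (R.index ⁻¹' {k}).indicator 1 s := fun k =>
    ((hf k).mono (R.ℱ.le K) le_rfl).mul (measurable_one.indicator (hpre k))
  rw [lintegral_finsetSum _ fun k _ => hmul k, Finset.sum_mul]
  refine Finset.sum_congr rfl fun k _ => ?_
  have hind : Measurable[MeasurableSpace.comap R.index inferInstance]
      ((R.index ⁻¹' {k}).indicator (1 : Ω → ℝ≥0∞)) :=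
    (measurable_one.indicator (measurableSet_singleton k) :
      Measurable (({k} : Set (Fin K)).indicator 1)).comp (comap_measurable R.index)
  rw [lintegral_mul_eq_lintegral_mul_lintegral_of_independent_measurableSpace (R.ℱ.le K)
    R.index_measurable.comap_le R.index_indep.symm (hf k) hind, lintegral_indicator_one (hpre k),
    R.index_uniform k]

variable [IsManifold 𝓘(ℝ, E) ∞ M]
  [IsContMDiffRiemannianBundle 𝓘(ℝ, E) ∞ E (fun x : M => TangentSpace 𝓘(ℝ, E) x)]
  [IsRiemannianManifold 𝓘(ℝ, E) M] [IsProbabilityMeasure P] [BorelSpace M]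
  [IsProbabilityMeasure μ]

/-- The expected gap at the output, for constant step sizes and batch sizes. -/
theorem Run.lintegral_fwGap_output_le (hX : IsCompact X) (hconv : IsGeodesicallyConvex E X)
    (hmeas : MeasurableGradOn E X φ) {Φ : M → ℝ}
    (hunbiased : ∀ x ∈ X, ∫ ξ, grad (E := E) (fun z => φ z ξ) x ∂P = grad (E := E) Φ x)
    {C : ℝ} (hC : ∀ x ∈ X, ∀ᵐ ξ ∂P, ‖grad (E := E) (fun z => φ z ξ) x‖ ≤ C)
    {L : ℝ} (hL : IsLSmoothOn E X L Φ) {D : ℝ} (hD : ∀ x ∈ X, ∀ y ∈ X, (edist x y).toReal ≤ D)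
    {A : ℝ} (hA : ∀ x ∈ X, ∀ y ∈ X, Φ x - Φ y ≤ A) {η : ℝ} (hη0 : 0 < η) (hη1 : η ≤ 1)
    {b : ℕ} (hb : 0 < b) (R : Run E X φ P K (fun _ => η) (fun _ => b) μ) :
    ∫⁻ s, ENNReal.ofReal (fwGap E X Φ (R.output s)) ∂μ ≤
      ENNReal.ofReal (A / η + K * (2 * D * (|C| / √(b : ℝ)) + η * (|L| / 2 * D ^ 2)))
        * (K : ℝ≥0∞)⁻¹ := by
  obtain ⟨s₀⟩ : Nonempty Ω := nonempty_of_isProbabilityMeasure μ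
  have hη : ∀ k : ℕ, (fun _ : ℕ => η) k ∈ Icc (0 : ℝ) 1 := fun _ => ⟨hη0.le, hη1⟩
  have hD0 : 0 ≤ D := ENNReal.toReal_nonneg.trans (hD _ (R.init_mem s₀) _ (R.init_mem s₀))
  set δ : ℕ → Ω → ℝ := fun k s => batchError E φ Φ (fun i => R.ξ k i s) (R.x k s) with hδ
  have hδ0 : ∀ k s, 0 ≤ δ k s := fun k s => norm_nonneg _
  set c := η * (|L| / 2 * D ^ 2)
  have hc : 0 ≤ c := by positivity
  -- A measurable majorant of the gap; it is nonnegative because the gap is, so `ENNReal.ofReal`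
  -- commutes with its sum and the telescoping survives.
  set B : ℕ → Ω → ℝ := fun k s => (Φ (R.x k s) - Φ (R.x (k + 1) s)) / η + 2 * D * δ k s + c with hB
  have hgap : ∀ k < K, ∀ s, fwGap E X Φ (R.x k s) ≤ B k s := by
    intro k hk s
    have h := R.mul_fwGap_le hconv hD hL hη hk s
    have h2 : η * B k s = Φ (R.x k s) - Φ (R.x (k + 1) s) + η * (2 * D * δ k s) + η * c := by
      simp only [hB]
      field_simp
    refine le_of_mul_le_mul_left ?_ hη0
    rw [h2]
    refine h.trans (le_of_eq ?_)
    simp only [c, hδ]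
    ring
  have hB0 : ∀ k < K, ∀ s, 0 ≤ B k s := fun k hk s =>
    (fwGap_nonneg hconv hD Φ (R.mem hη hk.le s)).trans (hgap k hk s)
  have hΦ : ∀ k ≤ K, Measurable[R.ℱ K] fun s => Φ (R.x k s) := by
    intro k hk
    have h1 : Measurable fun x : X => Φ x :=
      (continuousOn_iff_continuous_domRestrict.1 fun x hx =>
        (hL.1 x hx).continuousAt.continuousWithinAt).measurable
    exact h1.comp ((R.measurable_state hη hk).mono (R.ℱ.mono hk) le_rfl)
  have hδm : ∀ k < K, Measurable[R.ℱ K] (δ k) := fun k hk =>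
    (R.measurable_batchError hX hmeas hunbiased hC hη hk).mono (R.ℱ.mono hk) le_rfl
  have hBm : ∀ k < K, Measurable[R.ℱ K] (B k) := fun k hk =>
    ((((hΦ k hk.le).sub (hΦ (k + 1) hk)).div_const η).add ((hδm k hk).const_mul _)).add_const c
  have hout : ∫⁻ s, ENNReal.ofReal (fwGap E X Φ (R.output s)) ∂μ ≤
      ∫⁻ s, ENNReal.ofReal (B (R.index s) s) ∂μ :=
    lintegral_mono fun s => ENNReal.ofReal_le_ofReal (hgap _ (R.index s).2 s)
  refine hout.trans ?_
  rw [R.lintegral_index (f := fun k s => ENNReal.ofReal (B k s)) fun k =>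
    (hBm k k.2).ennreal_ofReal]
  gcongr
  rw [← lintegral_finsetSum _ fun (k : Fin K) _ =>
    ((hBm k k.2).mono (R.ℱ.le K) le_rfl).ennreal_ofReal]
  have htel : ∀ s, ∑ k : Fin K, ENNReal.ofReal (B k s) ≤
      ENNReal.ofReal (A / η + K * c) + ENNReal.ofReal (2 * D) * ∑ k : Fin K, ENNReal.ofReal (δ k s) := by
    intro s
    rw [← ENNReal.ofReal_sum_of_nonneg fun (k : Fin K) _ => hB0 k k.2 s,
      ← ENNReal.ofReal_sum_of_nonneg fun (k : Fin K) _ => hδ0 k s,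
      ← ENNReal.ofReal_mul (by positivity)]
    refine le_trans (ENNReal.ofReal_le_ofReal ?_) ENNReal.ofReal_add_le
    rw [Fin.sum_univ_eq_sum_range (fun k => B k s) K, Fin.sum_univ_eq_sum_range (fun k => δ k s) K]
    simp only [hB, Finset.sum_add_distrib, ← Finset.sum_div, ← Finset.mul_sum]
    rw [Finset.sum_range_sub' (fun k => Φ (R.x k s)) K]
    have h1 : (Φ (R.x 0 s) - Φ (R.x K s)) / η ≤ A / η := by
      gcongr
      exact hA _ (R.init_mem s) _ (R.mem hη le_rfl s)
    simp only [Finset.sum_const, Finset.card_range, nsmul_eq_mul]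
    linarith
  refine (lintegral_mono htel).trans ?_
  have hδΩ : ∀ k : Fin K, Measurable fun s => ENNReal.ofReal (δ k s) := fun k =>
    ((hδm k k.2).mono (R.ℱ.le K) le_rfl).ennreal_ofReal
  rw [lintegral_add_left measurable_const, lintegral_const, measure_univ, mul_one,
    lintegral_const_mul _ (Finset.measurable_fun_sum _ fun k _ => hδΩ k),
    lintegral_finsetSum _ fun k _ => hδΩ k]
  have hE : ∑ k : Fin K, ∫⁻ s, ENNReal.ofReal (δ k s) ∂μ ≤
      ENNReal.ofReal (K * (|C| / √(b : ℝ))) := by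
    refine (Finset.sum_le_sum fun k _ =>
      R.lintegral_batchError_le hX hmeas hunbiased hC hη k.2 hb).trans ?_
    rw [Finset.sum_const, Finset.card_univ, Fintype.card_fin, nsmul_eq_mul,
      ENNReal.ofReal_mul (by positivity), ENNReal.ofReal_natCast]
  have hA0 : 0 ≤ A := (sub_self (Φ (R.x 0 s₀))).symm.le.trans (hA _ (R.init_mem s₀) _ (R.init_mem s₀))
  calc ENNReal.ofReal (A / η + K * c) + ENNReal.ofReal (2 * D) * _
      ≤ ENNReal.ofReal (A / η + K * c)
        + ENNReal.ofReal (2 * D) * ENNReal.ofReal (K * (|C| / √(b : ℝ))) := by gcongr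
    _ = ENNReal.ofReal (A / η + K * (2 * D * (|C| / √(b : ℝ)) + c)) := by
      rw [← ENNReal.ofReal_mul (by positivity), ← ENNReal.ofReal_add (by positivity) (by positivity)]
      congr 1
      ring

end Convergence

end SRFW

theorem mainTheorem1
    {E : Type*} [NormedAddCommGroup E] [NormedSpace ℝ E] [FiniteDimensional ℝ E]
    {M : Type*} [EMetricSpace M] [ChartedSpace E M] [IsManifold 𝓘(ℝ, E) ∞ M]
    [RiemannianBundle (fun x : M => TangentSpace 𝓘(ℝ, E) x)]
    [IsContMDiffRiemannianBundle 𝓘(ℝ, E) ∞ E (fun x : M => TangentSpace 𝓘(ℝ, E) x)]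
    [IsRiemannianManifold 𝓘(ℝ, E) M]
    [MeasurableSpace M] [BorelSpace M]
    {Ξ : Type*} [MeasurableSpace Ξ] (P : Measure Ξ) [IsProbabilityMeasure P]
    (X : Set M) (hX : IsCompact X) (hconv : SRFW.IsGeodesicallyConvex E X)
    (φ : M → Ξ → ℝ) (Φ : M → ℝ)
    (hφ : ∀ᶠ x in 𝓝ˢ X, Integrable (φ x) P)
    (hΦ : ∀ x, Φ x = ∫ ξ, φ x ξ ∂P)
    (L : ℝ) (hL : SRFW.IsLSmoothOn E X L Φ)
    (hmeas : SRFW.MeasurableGradOn E X φ)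
    (hdiff : ∀ x ∈ X, ∀ᵐ ξ ∂P, MDifferentiableAt 𝓘(ℝ, E) 𝓘(ℝ, ℝ) (fun z => φ z ξ) x)
    (hunbiased : ∀ x ∈ X,
      ∫ ξ, SRFW.grad (E := E) (fun z => φ z ξ) x ∂P = SRFW.grad (E := E) Φ x)
    (C : ℝ) (hC : ∀ x ∈ X, ∀ᵐ ξ ∂P, ‖SRFW.grad (E := E) (fun z => φ z ξ) x‖ ≤ C) :
    ∃ B : ℝ, ∀ K : ℕ, 0 < K →
      ∀ (Ω : Type*) [MeasurableSpace Ω] (μ : Measure Ω) [IsProbabilityMeasure μ]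
        (R : SRFW.Run E X φ P K (fun _ => 1 / √(K : ℝ)) (fun _ => K) μ),
        ∫⁻ s, ENNReal.ofReal (SRFW.fwGap E X Φ (R.output s)) ∂μ
          ≤ ENNReal.ofReal (B / √(K : ℝ)) := by
  obtain ⟨D, hD0, hD⟩ := SRFW.exists_edist_le (E := E) hX hconv
  have hcont : ContinuousOn Φ X := fun x hx => (hL.1 x hx).continuousAt.continuousWithinAt
  obtain ⟨A, hA⟩ := hX.exists_bound_of_continuousOn hcont
  have hA2 : ∀ x ∈ X, ∀ y ∈ X, Φ x - Φ y ≤ 2 * A := by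
    intro x hx y hy
    have h1 := abs_le.1 (hA x hx)
    have h2 := abs_le.1 (hA y hy)
    linarith
  -- The three terms come from the oscillation of `Φ` on `X`, the minibatch error and the curvature.
  refine ⟨2 * A + 2 * D * |C| + |L| / 2 * D ^ 2, fun K hK Ω _ μ _ R => ?_⟩
  have hK' : (0 : ℝ) < K := by exact_mod_cast hK
  have hs : 0 < √(K : ℝ) := Real.sqrt_pos.2 hK'
  have hs1 : 1 ≤ √(K : ℝ) := Real.one_le_sqrt.2 (by exact_mod_cast hK)
  refine (R.lintegral_fwGap_output_le hX hconv hmeas hunbiased hC hL hD hA2 (by positivity)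
    ((div_le_one hs).2 hs1) hK).trans ?_
  have hinv : (K : ℝ≥0∞)⁻¹ = ENNReal.ofReal ((K : ℝ)⁻¹) := by
    rw [ENNReal.ofReal_inv_of_pos hK', ENNReal.ofReal_natCast]
  rw [hinv, ← ENNReal.ofReal_mul' (by positivity)]
  refine ENNReal.ofReal_le_ofReal (le_of_eq ?_)
  have hsq : √(K : ℝ) * √(K : ℝ) = K := Real.mul_self_sqrt hK'.le
  field_simp
  rw [show (√(K : ℝ)) ^ 2 = K by rw [sq, hsq]]
  ring
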